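/- **Theorem 2.3 (fourth order approximations of the left Riemann–Liouville derivative).** Let $\alpha\in(1,2)$. For $u:\mathbb R\to\mathbb C$ and $\beta\ge 0$, with $n=\lfloor\beta\rfloor+1$, the left Riemann–Liouville derivative of order $\beta$ is $$ {}_{-\infty}D_x^{\beta}u(x)=\frac{1}{\Gamma(n-\beta)}\,\frac{d^n}{dx^n}\int_{-\infty}^{x}(x-\xi)^{n-\beta-1}u(\xi)\,d\xi ,$$ and it is said to exist on $\mathbb R$ if the integral converges absolutely for every $x$ and is an $n$ times differentiable function of $x\in\mathbb R$. Let $q_k^\alpha=\left(\tfrac32\right)^{\alpha}\sum_{m=0}^{k}3^{-m}g_m^\alpha g_{k-m}^\alpha$ with $g_k^\alpha=(-1)^k\binom{\alpha}{k}$, i.e. $\left(\tfrac32-2\zeta+\tfrac12\zeta^2\right)^\alpha=\sum_{k\ge0}q_k^\alpha\zeta^k$. For $h>0$ and integers $p,q,r,s$ put $$A_p u(x)=\frac1{h^\alpha}\sum_{k=0}^\infty q_k^\alpha\,u\bigl(x-(k-p)h\bigr),\qquad A_{p,q}u=\frac{q}{q-p}A_pu+\frac{p}{p-q}A_qu\quad(p\ne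 q),$$ $$A_{p,q,r,s}u=\frac{3rs+2\alpha}{3(rs-pq)}A_{p,q}u+\frac{3pq+2\alpha}{3(pq-rs)}A_{r,s}u\quad(p\ne q,\ r\ne s,\ rs\neq pq),$$ $$a_{p,q,r,s}=rs-pq,\qquad b_{p,q,r,s}=6pqrs(r+s-p-q)+4\alpha\bigl[rs(r+s)-pq(p+q)\bigr]+9\alpha(rs-pq).$$ Let $p,q,r,s,\bar p,\bar q,\bar r,\bar s$ be integers with $p\ne q$, $r\ne s$, $rs\ne pq$, $\bar p\neq\bar q$, $\bar r\ne\bar s$, $\bar r\bar s\ne\bar p\bar q$. Write $a=a_{p,q,r,s}$, $b=b_{p,q,r,s}$, $\bar a=a_{\bar p,\bar q,\bar r,\bar s}$, $\bar b=b_{\bar p,\bar q,\bar r,\bar s}$, assume $a\bar b\ne\bar a b$, and define $$A^{(4)}_hu=\frac{a\bar b}{a\bar b-\bar a b}\,A_{p,q,r,s}u+\frac{\bar a b}{\bar a b-a\bar b}\,A_{\bar p,\bar q,\bar r,\bar s}u .$$ Suppose that $u\in L^1(\mathbb R)$, that ${}_{-\infty}D_x^{\alpha+4}u$ exists on $\mathbb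 R$ and belongs to $L^1(\mathbb R)$, and that the Fourier transforms of $u$ and of ${}_{-\infty}D_x^{\alpha+4}u$ belong to $L^1(\mathbb R)$. Then ${}_{-\infty}D_x^{\alpha}u$ exists on $\mathbb R$, and $${}_{-\infty}D_x^{\alpha}u(x)=A^{(4)}_hu(x)+\mathcal O(h^4)$$ uniformly in $x$: there is a constant $C$ (independent of $h$ and $x$) such that for every $h>0$ the series defining $A^{(4)}_hu(x)$ converge and $$\bigl|{}_{-\infty}D_x^{\alpha}u(x)-A^{(4)}_hu(x)\bigr|\le C\,h^4$$ for almost every $x\in\mathbb R$, and for every $x\in\mathbb R$ if $u$ is continuous. -/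

import Mathlib

open MeasureTheory FourierTransform

noncomputable section

/-- The left Riemann–Liouville (Liouville–Weyl) fractional integral of order `σ > 0` with base
point `-∞`: `(1 / Γ(σ)) ∫_{-∞}^x (x - ξ)^(σ - 1) u(ξ) dξ`. -/
def rlIntegral (σ : ℝ) (u : ℝ → ℂ) (x : ℝ) : ℂ :=
  (1 / Real.Gamma σ) • ∫ ξ in Set.Iic x, ((x - ξ) ^ (σ - 1)) • u ξ

/-- The left Riemann–Liouville derivative `_{-∞}D_x^β u` of order `β ≥ 0`: with `n = ⌊β⌋ + 1`, the
`n`-th derivative of the fractional integral of order `n - β`. For `β = α ∈ (1,2)` this is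
`(1 / Γ(2-α)) (d/dx)² ∫_{-∞}^x (x - ξ)^(1-α) u(ξ) dξ`, and for `β = α + 4` it is the sixth
derivative of the same integral. -/
def rlDeriv (β : ℝ) (u : ℝ → ℂ) : ℝ → ℂ :=
  iteratedDeriv (⌊β⌋₊ + 1) (rlIntegral (((⌊β⌋₊ + 1 : ℕ) : ℝ) - β) u)

/-- The left Riemann–Liouville derivative of order `β` exists at every point of the line: the
integral in its definition converges absolutely, and it is `⌊β⌋ + 1` times differentiable. -/
def RLDifferentiable (β : ℝ) (u : ℝ → ℂ) : Prop :=
  (∀ x : ℝ, IntegrableOn (fun ξ : ℝ => ((x - ξ) ^ ((((⌊β⌋₊ + 1 : ℕ) : ℝ) - β) - 1)) • u ξ)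
    (Set.Iic x)) ∧
  ∀ k : ℕ, k < ⌊β⌋₊ + 1 →
    Differentiable ℝ (iteratedDeriv k (rlIntegral (((⌊β⌋₊ + 1 : ℕ) : ℝ) - β) u))

/-- `g_k^α = (-1)^k (α choose k)`, the coefficients of `(1 - ζ)^α`. -/
def grunwaldCoeff (α : ℝ) (k : ℕ) : ℝ :=
  (-1) ^ k * Ring.choose α k

/-- `q_k^α`, the coefficients of `(3/2 - 2ζ + ζ²/2)^α`. -/
def lubichCoeff (α : ℝ) (k : ℕ) : ℝ :=
  (3 / 2 : ℝ) ^ α *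
    ∑ m ∈ Finset.range (k + 1), ((3 : ℝ) ^ m)⁻¹ * grunwaldCoeff α m * grunwaldCoeff α (k - m)

/-- The second order Lubich operator with step `h`, shifted by `p`:
`h^(-α) ∑_{k ≥ 0} q_k^α u(x - (k - p) h)`. -/
def lubichOp (α h : ℝ) (p : ℤ) (u : ℝ → ℂ) (x : ℝ) : ℂ :=
  (1 / h ^ α) • ∑' k : ℕ, lubichCoeff α k • u (x - ((k : ℝ) - (p : ℝ)) * h)

/-- The series defining the shifted Lubich operators at `x` converge, for all shifts. -/
def LubichSummable (α h : ℝ) (u : ℝ → ℂ) (x : ℝ) : Prop :=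
  ∀ p : ℤ, Summable fun k : ℕ => lubichCoeff α k • u (x - ((k : ℝ) - (p : ℝ)) * h)

/-- `w_p A_p + w_q A_q` with `w_p = q / (q - p)` and `w_q = p / (p - q)`. -/
def wsldOp2 (α h : ℝ) (p q : ℤ) (u : ℝ → ℂ) (x : ℝ) : ℂ :=
  ((q : ℝ) / ((q : ℝ) - (p : ℝ))) • lubichOp α h p u x +
    ((p : ℝ) / ((p : ℝ) - (q : ℝ))) • lubichOp α h q u x

/-- The weight `w_{p,q} = (3 r s + 2 α) / (3 (r s - p q))`; the weight `w_{r,s}` is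
`weight3 α r s p q`. -/
def weight3 (α : ℝ) (p q r s : ℤ) : ℝ :=
  (3 * (r : ℝ) * (s : ℝ) + 2 * α) / (3 * ((r : ℝ) * (s : ℝ) - (p : ℝ) * (q : ℝ)))

/-- `w_{p,q} A_{p,q} + w_{r,s} A_{r,s}`. -/
def wsldOp3 (α h : ℝ) (p q r s : ℤ) (u : ℝ → ℂ) (x : ℝ) : ℂ :=
  weight3 α p q r s • wsldOp2 α h p q u x + weight3 α r s p q • wsldOp2 α h r s u x

/-- `a_{p,q,r,s} = r s - p q`. -/
def coeffA (p q r s : ℤ) : ℝ :=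
  (r : ℝ) * (s : ℝ) - (p : ℝ) * (q : ℝ)

/-- `b_{p,q,r,s} = 6pqrs(r + s - p - q) + 4α[rs(r + s) - pq(p + q)] + 9α(rs - pq)`. -/
def coeffB (α : ℝ) (p q r s : ℤ) : ℝ :=
  6 * (p : ℝ) * (q : ℝ) * (r : ℝ) * (s : ℝ) * ((r : ℝ) + (s : ℝ) - (p : ℝ) - (q : ℝ)) +
    4 * α * ((r : ℝ) * (s : ℝ) * ((r : ℝ) + (s : ℝ)) -
      (p : ℝ) * (q : ℝ) * ((p : ℝ) + (q : ℝ))) +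
    9 * α * ((r : ℝ) * (s : ℝ) - (p : ℝ) * (q : ℝ))

/-- The fourth order operator `w A_{p,q,r,s} + w' A_{p',q',r',s'}` with
`w = a b' / (a b' - a' b)` and `w' = a' b / (a' b - a b')`, where `a, b` belong to `(p,q,r,s)` and
`a', b'` to `(p',q',r',s')`. -/
def wsldOp4 (α h : ℝ) (p q r s p' q' r' s' : ℤ) (u : ℝ → ℂ) (x : ℝ) : ℂ :=
  (coeffA p q r s * coeffB α p' q' r' s' /
      (coeffA p q r s * coeffB α p' q' r' s' - coeffA p' q' r' s' * coeffB α p q r s)) •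
    wsldOp3 α h p q r s u x +
  (coeffA p' q' r' s' * coeffB α p q r s /
      (coeffA p' q' r' s' * coeffB α p q r s - coeffA p q r s * coeffB α p' q' r' s')) •
    wsldOp3 α h p' q' r' s' u x

end

/-! Everything is done on the Fourier side. Put z = 2πiw and let f be the transform of u. Damping
the kernel by exp(-ε(x - ξ)) and letting ε → 0 shows that the fractional integral of order 2 - α is
the inverse transform of (1/z)^(2-α) f (`rlIntegral_eq_fourierInv`). Its sixth derivative is
integrable with integrable transform, and `fourier_iteratedDeriv_fourierInv` identifies that
transform as z^6 (1/z)^(2-α) f. Hence |w|^(α+4) f is integrable, and the derivative of order α is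
the inverse transform of z^α f.

A Lubich operator with step h and shift p multiplies f by h^(-α) e^(phz) L(e^(-hz)), where L is the
generating function of the coefficients. Since L(ζ) = (3/2 - 2ζ + ζ²/2)^α, the symbol near 0 is
(hz)^α times a power series in hz. The fourth order weights have the moments 1, 0, 2α/3, -3α/2,
exactly those that reduce this series to 1 + O((hz)^4). Far from 0 the symbol is bounded, so the
error is at most C|y|^(α+4) for every y = 2πwh ≠ 0 (`FourthOrderWeights.norm_symbol_sub_le`).
Integrating against |f| and dividing by h^α leaves C h^4, uniformly in x. -/

noncomputable section

/-! ### Fourier inversion and injectivity for integrable functions. -/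

theorem fourierInv_real_eq_integral (f : ℝ → ℂ) (x : ℝ) :
    𝓕⁻ f x = ∫ w : ℝ, Complex.exp (2 * Real.pi * w * x * Complex.I) * f w := by
  rw [Real.fourierInv_eq']
  congr 1 with w
  simp only [smul_eq_mul, RCLike.inner_apply, conj_trivial]
  congr 2
  push_cast
  ring

theorem norm_cexp_two_pi_mul (w x : ℝ) :
    ‖Complex.exp (2 * Real.pi * w * x * Complex.I)‖ = 1 := by
  have := Complex.norm_exp_ofReal_mul_I (2 * Real.pi * w * x)
  push_cast at this
  exact this

theorem integrable_cexp_mul {f : ℝ → ℂ} (hf : Integrable f) (x : ℝ) :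
    Integrable fun w : ℝ => Complex.exp (2 * Real.pi * w * x * Complex.I) * f w := by
  refine hf.bdd_mul (c := 1) ?_ ?_
  · exact Continuous.aestronglyMeasurable (by fun_prop)
  · exact Filter.Eventually.of_forall fun w => (norm_cexp_two_pi_mul w x).le

theorem continuous_fourierInv_of_integrable {f : ℝ → ℂ} (hf : Integrable f) :
    Continuous (𝓕⁻ f) :=
  VectorFourier.fourierIntegral_continuous Real.continuous_fourierChar (by fun_prop) hf

theorem norm_fourier_le_integral (f : ℝ → ℂ) (w : ℝ) : ‖𝓕 f w‖ ≤ ∫ x, ‖f x‖ :=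
  VectorFourier.norm_fourierIntegral_le_integral_norm _ _ _ _ _

theorem norm_fourierInv_le_integral (f : ℝ → ℂ) (w : ℝ) : ‖𝓕⁻ f w‖ ≤ ∫ x, ‖f x‖ :=
  VectorFourier.norm_fourierIntegral_le_integral_norm _ _ _ _ _

theorem integral_fourier_mul_of_integrable {f g : ℝ → ℂ} (hf : Integrable f)
    (hg : Integrable g) : ∫ x, 𝓕 f x * g x = ∫ x, f x * 𝓕 g x := by
  have := VectorFourier.integral_fourierIntegral_smul_eq_flip (L := innerₗ ℝ)
    Real.continuous_fourierChar (by fun_prop) hf hg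
  rw [flip_innerₗ] at this
  exact this

theorem integral_fourierInv_mul_of_integrable {f g : ℝ → ℂ} (hf : Integrable f)
    (hg : Integrable g) : ∫ x, 𝓕⁻ f x * g x = ∫ x, f x * 𝓕⁻ g x := by
  have := VectorFourier.integral_fourierIntegral_smul_eq_flip (L := -innerₗ ℝ)
    Real.continuous_fourierChar (by fun_prop) hf hg
  have h2 : (-innerₗ ℝ : ℝ →ₗ[ℝ] ℝ →ₗ[ℝ] ℝ).flip = -innerₗ ℝ := by
    ext; simp
  rw [h2] at this
  exact this

open scoped ContDiff in
-- Continuity of `u` is not assumed, so equality is only almost everywhere and is tested against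
-- smooth compactly supported functions. Such a function is 𝓕 ψ with ψ Schwartz; moving the
-- transforms across the pairing turns both integrals into ∫ 𝓕 u · ψ.
theorem ae_eq_fourierInv_fourier {u : ℝ → ℂ} (hu : Integrable u) (hu' : Integrable (𝓕 u)) :
    ∀ᵐ x, u x = 𝓕⁻ (𝓕 u) x := by
  refine ae_eq_of_integral_contDiff_smul_eq hu.locallyIntegrable
    (continuous_fourierInv_of_integrable hu').locallyIntegrable fun g hg hgs => ?_
  have hgs' : HasCompactSupport fun x => (g x : ℂ) :=
    hgs.comp_left (g := ((↑) : ℝ → ℂ)) Complex.ofReal_zero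
  have hg' : ContDiff ℝ ∞ fun x => (g x : ℂ) := Complex.ofRealCLM.contDiff.comp hg
  let φ : SchwartzMap ℝ ℂ := hgs'.toSchwartzMap hg'
  have hφ : ∀ x, φ x = g x := fun x => rfl
  let ψ : SchwartzMap ℝ ℂ := 𝓕⁻ φ
  have h1 : 𝓕 (ψ : ℝ → ℂ) = φ := by
    rw [← SchwartzMap.fourier_coe, FourierTransform.fourier_fourierInv_eq]
  have h2 : 𝓕⁻ (φ : ℝ → ℂ) = ψ := (SchwartzMap.fourierInv_coe φ).symm
  have e1 : ∫ x, g x • u x = ∫ x, u x * φ x := by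
    congr 1 with x
    rw [hφ, Complex.real_smul, mul_comm]
  have e2 : ∫ x, g x • 𝓕⁻ (𝓕 u) x = ∫ x, 𝓕⁻ (𝓕 u) x * φ x := by
    congr 1 with x
    rw [hφ, Complex.real_smul, mul_comm]
  rw [e1, e2, integral_fourierInv_mul_of_integrable hu' φ.integrable, h2, ← h1,
    integral_fourier_mul_of_integrable hu ψ.integrable]

theorem ae_eq_of_fourierInv_eq {f g : ℝ → ℂ} (hf : Integrable f) (hg : Integrable g)
    (h : ∀ x, 𝓕⁻ f x = 𝓕⁻ g x) : ∀ᵐ x, f x = g x := by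
  have h0 : 𝓕 (fun x => f x - g x) = fun _ => 0 := by
    ext x
    have hx := h (-x)
    rw [fourierInv_real_eq_integral, fourierInv_real_eq_integral] at hx
    have : 𝓕 (fun x => f x - g x) x = 𝓕⁻ (fun x => f x - g x) (-x) := by
      rw [Real.fourierInv_eq_fourier_neg, neg_neg]
    rw [this, fourierInv_real_eq_integral]
    simp_rw [mul_sub]
    rw [integral_sub (integrable_cexp_mul hf _) (integrable_cexp_mul hg _), hx, sub_self]
  have := ae_eq_fourierInv_fourier (hf.sub hg) (u := fun x => f x - g x)
    (by rw [h0]; exact integrable_zero _ _ _)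
  filter_upwards [this] with x hx
  rw [h0, fourierInv_real_eq_integral] at hx
  simpa [sub_eq_zero] using hx

/-! ### Laplace transform of a power. -/

theorem integrableOn_rpow_mul_exp_neg {s b : ℝ} (hs : -1 < s) (hb : 0 < b) :
    IntegrableOn (fun t : ℝ => t ^ s * Real.exp (-(b * t))) (Set.Ioi 0) := by
  have := integrableOn_rpow_mul_exp_neg_mul_rpow (p := 1) hs one_pos hb
  simpa using this

theorem norm_rpow_mul_cexp_neg {s t : ℝ} (ht : 0 < t) (r : ℂ) :
    ‖((t ^ s : ℝ) : ℂ) * Complex.exp (-(r * t))‖ = t ^ s * Real.exp (-(r.re * t)) := by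
  rw [norm_mul, Complex.norm_real, Complex.norm_exp, Real.norm_of_nonneg (by positivity)]
  simp

theorem measurable_rpow_mul_cexp_neg (s : ℝ) (r : ℂ) :
    Measurable fun t : ℝ => ((t ^ s : ℝ) : ℂ) * Complex.exp (-(r * t)) := by
  fun_prop

theorem integrableOn_rpow_mul_cexp_neg {s : ℝ} (hs : -1 < s) {r : ℂ} (hr : 0 < r.re) :
    IntegrableOn (fun t : ℝ => ((t ^ s : ℝ) : ℂ) * Complex.exp (-(r * t))) (Set.Ioi 0) := by
  refine (integrableOn_rpow_mul_exp_neg hs hr).mono'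
    (measurable_rpow_mul_cexp_neg s r).aestronglyMeasurable ?_
  filter_upwards [ae_restrict_mem measurableSet_Ioi] with t ht
  exact (norm_rpow_mul_cexp_neg ht r).le

/-- The Laplace transform of `t ^ (s - 1)` in the right half plane. -/
theorem integral_rpow_mul_cexp_neg {s : ℝ} (hs : 0 < s) {r : ℂ} (hr : 0 < r.re) :
    ∫ t in Set.Ioi (0 : ℝ), ((t ^ (s - 1) : ℝ) : ℂ) * Complex.exp (-(r * t)) =
      (1 / r) ^ (s : ℂ) * Complex.Gamma s := by
  -- Both sides are holomorphic on the right half plane and agree at real points by the Gamma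
  -- integral; the identity theorem is applied along 1 + 1/(n+1) → 1.
  let U : Set ℂ := {r | 0 < r.re}
  have hUo : IsOpen U := isOpen_lt continuous_const Complex.continuous_re
  have hUc : IsPreconnected U := (convex_halfSpace_re_gt 0).isPreconnected
  let J : ℂ → ℂ := fun r => ∫ t in Set.Ioi (0 : ℝ),
    ((t ^ (s - 1) : ℝ) : ℂ) * Complex.exp (-(r * t))
  have hJ : DifferentiableOn ℂ J U := by
    intro r₀ hr₀
    have hr₀' : 0 < r₀.re := hr₀
    refine DifferentiableAt.differentiableWithinAt ?_
    have hball : ∀ z ∈ Metric.ball r₀ (r₀.re / 2), r₀.re / 2 < z.re := by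
      intro z hz
      have h1 : |(z - r₀).re| ≤ ‖z - r₀‖ := Complex.abs_re_le_norm _
      rw [Metric.mem_ball, dist_eq_norm] at hz
      rw [Complex.sub_re] at h1
      have := (abs_le.mp (h1.trans hz.le)).1
      have := neg_abs_le (z.re - r₀.re)
      linarith
    refine (hasDerivAt_integral_of_dominated_loc_of_deriv_le
      (F := fun (r : ℂ) (t : ℝ) => ((t ^ (s - 1) : ℝ) : ℂ) * Complex.exp (-(r * t)))
      (F' := fun (r : ℂ) (t : ℝ) => -(((t ^ s : ℝ) : ℂ) * Complex.exp (-(r * t))))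
      (bound := fun t => t ^ s * Real.exp (-(r₀.re / 2 * t)))
      (Metric.ball_mem_nhds r₀ (half_pos hr₀')) ?_ ?_ ?_ ?_ ?_ ?_).2.differentiableAt
    · exact Filter.Eventually.of_forall fun r =>
        (measurable_rpow_mul_cexp_neg _ r).aestronglyMeasurable
    · exact integrableOn_rpow_mul_cexp_neg (by linarith) hr₀'
    · exact (measurable_rpow_mul_cexp_neg _ _).neg.aestronglyMeasurable
    · filter_upwards [ae_restrict_mem measurableSet_Ioi] with t ht z hz
      rw [norm_neg, norm_rpow_mul_cexp_neg ht]
      have ht' : 0 < t := ht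
      have := hball z hz
      gcongr
    · exact integrableOn_rpow_mul_exp_neg (by linarith) (by linarith)
    · filter_upwards [ae_restrict_mem measurableSet_Ioi] with t ht z hz
      have ht' : 0 < t := ht
      have h1 : HasDerivAt (fun z : ℂ => -(z * t)) (-(1 * (t : ℂ))) z :=
        ((hasDerivAt_id z).mul_const _).neg
      have h2 := (h1.cexp).const_mul (((t ^ (s - 1) : ℝ) : ℂ))
      refine h2.congr_deriv ?_
      have : t ^ s = t ^ (s - 1) * t := by
        rw [← Real.rpow_add_one ht'.ne']; congr 1; ring
      rw [this]
      push_cast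
      ring
  have hR : DifferentiableOn ℂ (fun r : ℂ => (1 / r) ^ (s : ℂ) * Complex.Gamma s) U := by
    intro r hr
    have hr' : 0 < r.re := hr
    have hne : r ≠ 0 := by rintro rfl; simp at hr'
    refine DifferentiableAt.differentiableWithinAt ?_
    refine DifferentiableAt.mul_const ?_ _
    refine DifferentiableAt.cpow_const ?_ ?_
    · exact (differentiableAt_const _).div differentiableAt_id hne
    · left
      rw [one_div, Complex.inv_re]
      exact div_pos hr' (Complex.normSq_pos.mpr hne)
  refine (hJ.analyticOnNhd hUo).eqOn_of_preconnected_of_frequently_eq (hR.analyticOnNhd hUo) hUc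
    (z₀ := 1) (by simp [U]) ?_ hr
  have hseq : Filter.Tendsto (fun n : ℕ => (((1 + 1 / ((n : ℝ) + 1) : ℝ)) : ℂ)) Filter.atTop
      (nhdsWithin 1 {1}ᶜ) := by
    refine tendsto_nhdsWithin_iff.mpr ⟨?_, Filter.Eventually.of_forall fun n => ?_⟩
    · have h1 : Filter.Tendsto (fun n : ℕ => 1 + 1 / ((n : ℝ) + 1)) Filter.atTop (nhds (1 + 0)) :=
        tendsto_const_nhds.add tendsto_one_div_add_atTop_nhds_zero_nat
      rw [add_zero] at h1
      have h2 := (Complex.continuous_ofReal.tendsto _).comp h1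
      rwa [Complex.ofReal_one] at h2
    · have : (0 : ℝ) < 1 / ((n : ℝ) + 1) := by positivity
      rw [Set.mem_compl_iff, Set.mem_singleton_iff, ← Complex.ofReal_one, Complex.ofReal_inj]
      linarith
  refine hseq.frequently (Filter.Eventually.frequently (Filter.Eventually.of_forall fun n => ?_))
  have hpos : (0 : ℝ) < 1 + 1 / ((n : ℝ) + 1) := by positivity
  rw [← Complex.integral_cpow_mul_exp_neg_mul_Ioi (by simpa using hs) hpos]
  refine setIntegral_congr_fun measurableSet_Ioi fun t ht => ?_
  have ht' : (0 : ℝ) < t := ht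
  rw [Complex.ofReal_cpow ht'.le]
  push_cast
  rfl

/-! ### The fractional integral as an inverse Fourier transform. -/

/-- Near 0 the power is integrable because σ < 1 and `f` is bounded; for |w| ≥ 1 the power is at
most 1 and `f` is integrable. -/
theorem integrable_norm_rpow_neg_mul {f : ℝ → ℂ} (hf : Integrable f) {M : ℝ}
    (hM : ∀ w, ‖f w‖ ≤ M) {σ : ℝ} (hσ : σ ∈ Set.Ioo (0 : ℝ) 1) :
    Integrable fun w : ℝ => |w| ^ (-σ) * ‖f w‖ := by
  have h1 : IntegrableOn (fun w : ℝ => |w| ^ (-σ)) (Set.Ioc (-1) 1) := by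
    have := intervalIntegral.intervalIntegrable_cpow' (a := -1) (b := 1)
      (r := ((-σ : ℝ) : ℂ)) (by rw [Complex.ofReal_re]; linarith [hσ.2])
    rw [intervalIntegrable_iff_integrableOn_Ioc_of_le (by norm_num)] at this
    refine this.norm.congr (Filter.Eventually.of_forall fun w => ?_)
    simp only
    rw [Complex.norm_cpow_real, Complex.norm_real, Real.norm_eq_abs]
  have h2 : Integrable ((Set.Ioc (-1) 1).indicator fun w : ℝ => |w| ^ (-σ)) :=
    (integrable_indicator_iff measurableSet_Ioc).mpr h1
  refine ((h2.const_mul M).add hf.norm).mono' ?_ (Filter.Eventually.of_forall fun w => ?_)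
  · have : Measurable fun w : ℝ => |w| ^ (-σ) := by fun_prop
    exact this.aestronglyMeasurable.mul hf.norm.aestronglyMeasurable
  · have hM0 : 0 ≤ M := (norm_nonneg _).trans (hM 0)
    rw [Real.norm_of_nonneg (by positivity)]
    by_cases hw : w ∈ Set.Ioc (-1 : ℝ) 1
    · simp only [Pi.add_apply, Set.indicator_of_mem hw]
      have : |w| ^ (-σ) * ‖f w‖ ≤ |w| ^ (-σ) * M := by gcongr; exact hM w
      linarith [norm_nonneg (f w)]
    · simp only [Pi.add_apply, Set.indicator_of_notMem hw, mul_zero, zero_add]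
      have hw1 : 1 ≤ |w| := by
        by_contra hlt
        push Not at hlt
        exact hw ⟨(abs_lt.mp hlt).1, (abs_lt.mp hlt).2.le⟩
      exact mul_le_of_le_one_left (norm_nonneg _)
        (Real.rpow_le_one_of_one_le_of_nonpos hw1 (by linarith [hσ.1]))

/-- The Fourier transform of the fractional integral of order `σ`, in terms of that of the
function. -/
def rlSymbolMul (σ : ℝ) (f : ℝ → ℂ) (w : ℝ) : ℂ :=
  (1 / (2 * Real.pi * w * Complex.I)) ^ (σ : ℂ) * f w

theorem norm_two_pi_mul_I (w : ℝ) : ‖2 * Real.pi * w * Complex.I‖ = 2 * Real.pi * |w| := by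
  simp [abs_of_pos Real.pi_pos]

theorem norm_rlSymbolMul (σ : ℝ) (f : ℝ → ℂ) (w : ℝ) :
    ‖rlSymbolMul σ f w‖ = (2 * Real.pi) ^ (-σ) * (|w| ^ (-σ) * ‖f w‖) := by
  rw [rlSymbolMul, norm_mul, Complex.norm_cpow_real, norm_div, norm_one, norm_two_pi_mul_I,
    one_div, Real.inv_rpow (by positivity), ← Real.rpow_neg (by positivity),
    Real.mul_rpow (by positivity) (abs_nonneg w), mul_assoc]

theorem integrable_rlSymbolMul {f : ℝ → ℂ} (hf : Integrable f) {M : ℝ}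
    (hM : ∀ w, ‖f w‖ ≤ M) {σ : ℝ} (hσ : σ ∈ Set.Ioo (0 : ℝ) 1) :
    Integrable (rlSymbolMul σ f) := by
  refine ((integrable_norm_rpow_neg_mul hf hM hσ).const_mul ((2 * Real.pi) ^ (-σ))).mono' ?_
    (Filter.Eventually.of_forall fun w => (norm_rlSymbolMul σ f w).le)
  have : Measurable fun w : ℝ => (1 / (2 * Real.pi * w * Complex.I)) ^ (σ : ℂ) := by fun_prop
  exact this.aestronglyMeasurable.mul hf.aestronglyMeasurable

/-- The kernel of the fractional integral at `x`, damped by `exp (-ε (x - ξ))`. -/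
def dampedKernel (σ ε x ξ : ℝ) : ℂ :=
  (Set.Iio x).indicator
    (fun ξ => (((x - ξ) ^ (σ - 1) : ℝ) : ℂ) * Complex.exp (-((ε : ℂ) * (x - ξ)))) ξ

theorem dampedKernel_sub (σ ε x t : ℝ) : dampedKernel σ ε x (x - t) =
    (Set.Ioi 0).indicator
      (fun t : ℝ => ((t ^ (σ - 1) : ℝ) : ℂ) * Complex.exp (-((ε : ℂ) * t))) t := by
  by_cases ht : 0 < t
  · simp [dampedKernel, Set.indicator, ht]
  · simp [dampedKernel, Set.indicator, ht]

theorem integrable_dampedKernel {σ ε : ℝ} (hσ : 0 < σ) (hε : 0 < ε) (x : ℝ) :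
    Integrable (dampedKernel σ ε x) := by
  rw [← integrable_comp_sub_left _ x]
  simp_rw [dampedKernel_sub]
  rw [integrable_indicator_iff measurableSet_Ioi]
  exact integrableOn_rpow_mul_cexp_neg (by linarith) (by simpa using hε)

/-- The substitution ξ = x - t produces the Laplace transform at ε + 2πiw. Without damping, the
kernel would not be integrable at -∞. -/
theorem fourierInv_dampedKernel {σ ε : ℝ} (hσ : 0 < σ) (hε : 0 < ε) (x w : ℝ) :
    𝓕⁻ (dampedKernel σ ε x) w = Complex.exp (2 * Real.pi * w * x * Complex.I) *
      ((1 / (ε + 2 * Real.pi * w * Complex.I)) ^ (σ : ℂ) * Complex.Gamma σ) := by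
  rw [fourierInv_real_eq_integral, ← integral_sub_left_eq_self _ volume x]
  simp_rw [dampedKernel_sub]
  rw [← integral_rpow_mul_cexp_neg hσ (r := ε + 2 * Real.pi * w * Complex.I) (by simpa using hε),
    ← integral_indicator measurableSet_Ioi, ← integral_const_mul]
  congr 1 with t
  by_cases ht : t ∈ Set.Ioi (0 : ℝ)
  · rw [Set.indicator_of_mem ht, Set.indicator_of_mem ht]
    have e : Complex.exp (2 * Real.pi * (x - t : ℝ) * w * Complex.I) *
        Complex.exp (-((ε : ℂ) * t)) = Complex.exp (2 * Real.pi * w * x * Complex.I) *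
        Complex.exp (-((ε + 2 * Real.pi * w * Complex.I) * t)) := by
      rw [← Complex.exp_add, ← Complex.exp_add]
      congr 1
      push_cast
      ring
    linear_combination ((t ^ (σ - 1) : ℝ) : ℂ) * e
  · rw [Set.indicator_of_notMem ht, Set.indicator_of_notMem ht, mul_zero, mul_zero]

theorem integral_mul_dampedKernel {σ ε : ℝ} (hσ : 0 < σ) (hε : 0 < ε) (x : ℝ)
    {u : ℝ → ℂ} (hu : Integrable u) (hu' : Integrable (𝓕 u)) :
    ∫ ξ, u ξ * dampedKernel σ ε x ξ =
      ∫ w, 𝓕 u w * (Complex.exp (2 * Real.pi * w * x * Complex.I) *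
        ((1 / (ε + 2 * Real.pi * w * Complex.I)) ^ (σ : ℂ) * Complex.Gamma σ)) := by
  have h1 : ∫ ξ, u ξ * dampedKernel σ ε x ξ = ∫ ξ, 𝓕⁻ (𝓕 u) ξ * dampedKernel σ ε x ξ := by
    refine integral_congr_ae ?_
    filter_upwards [ae_eq_fourierInv_fourier hu hu'] with ξ hξ
    rw [← hξ]
  rw [h1, integral_fourierInv_mul_of_integrable hu' (integrable_dampedKernel hσ hε x)]
  simp_rw [fourierInv_dampedKernel hσ hε]

/-- Abel summation: let ε → 0 in `integral_mul_dampedKernel`. On the left the absolutely convergent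
integral at `x` dominates. On the right |ε + 2πiw| ≥ 2π|w|, so the limiting symbol dominates. -/
theorem rlIntegral_eq_fourierInv {σ : ℝ} (hσ : σ ∈ Set.Ioo (0 : ℝ) 1)
    {u : ℝ → ℂ} (hu : Integrable u) (hu' : Integrable (𝓕 u)) {x : ℝ}
    (hx : IntegrableOn (fun ξ : ℝ => ((x - ξ) ^ (σ - 1)) • u ξ) (Set.Iic x)) :
    rlIntegral σ u x = 𝓕⁻ (rlSymbolMul σ (𝓕 u)) x := by
  have hσ0 : 0 < σ := hσ.1
  let ε : ℕ → ℝ := fun n => 1 / ((n : ℝ) + 1)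
  have hε : ∀ n, 0 < ε n := fun n => by positivity
  have hε0 : Filter.Tendsto ε Filter.atTop (nhds 0) := tendsto_one_div_add_atTop_nhds_zero_nat
  have hεc : Filter.Tendsto (fun n => (ε n : ℂ)) Filter.atTop (nhds 0) := by
    have := (Complex.continuous_ofReal.tendsto 0).comp hε0
    rwa [Complex.ofReal_zero] at this
  have hx' : Integrable ((Set.Iio x).indicator fun ξ : ℝ => ((x - ξ) ^ (σ - 1)) • u ξ) :=
    (integrable_indicator_iff measurableSet_Iio).mpr (hx.mono_set Set.Iio_subset_Iic_self)
  have hL : Filter.Tendsto (fun n => ∫ ξ, u ξ * dampedKernel σ (ε n) x ξ) Filter.atTop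
      (nhds (∫ ξ, (Set.Iio x).indicator (fun ξ : ℝ => ((x - ξ) ^ (σ - 1)) • u ξ) ξ)) := by
    refine tendsto_integral_of_dominated_convergence _ ?_ hx'.norm ?_ ?_
    · exact fun n => hu.aestronglyMeasurable.mul
        (integrable_dampedKernel hσ0 (hε n) x).aestronglyMeasurable
    · refine fun n => Filter.Eventually.of_forall fun ξ => ?_
      by_cases hξ : ξ ∈ Set.Iio x
      · rw [dampedKernel, Set.indicator_of_mem hξ, Set.indicator_of_mem hξ, norm_mul, norm_mul,
          norm_smul, Complex.norm_real, Complex.norm_exp, mul_left_comm, mul_comm ‖u ξ‖,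
          ← mul_assoc]
        have h0 : 0 < x - ξ := sub_pos.mpr hξ
        have h1 : (-((ε n : ℂ) * ((x : ℂ) - ξ))).re = -(ε n * (x - ξ)) := by simp
        rw [h1, mul_right_comm]
        refine mul_le_of_le_one_right (by positivity) ?_
        rw [Real.exp_le_one_iff]
        have := mul_pos (hε n) h0
        linarith
      · rw [dampedKernel, Set.indicator_of_notMem hξ, Set.indicator_of_notMem hξ]
        simp
    · refine Filter.Eventually.of_forall fun ξ => ?_
      by_cases hξ : ξ ∈ Set.Iio x
      · simp_rw [dampedKernel, Set.indicator_of_mem hξ]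
        have h2 : Filter.Tendsto (fun n => Complex.exp (-((ε n : ℂ) * ((x : ℂ) - ξ))))
            Filter.atTop (nhds (Complex.exp (-((0 : ℂ) * ((x : ℂ) - ξ))))) :=
          ((Complex.continuous_exp.tendsto _).comp (hεc.mul_const _).neg)
        have h3 := ((h2.const_mul ((((x - ξ) ^ (σ - 1) : ℝ) : ℂ))).const_mul (u ξ))
        convert h3 using 2
        rw [Complex.real_smul]
        simp [mul_comm]
      · simp_rw [dampedKernel, Set.indicator_of_notMem hξ]
        simp
  have hu0 : ∀ w, ‖𝓕 u w‖ ≤ ∫ x, ‖u x‖ := norm_fourier_le_integral u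
  have hR : Filter.Tendsto (fun n => ∫ w, 𝓕 u w *
      (Complex.exp (2 * Real.pi * w * x * Complex.I) *
        ((1 / (ε n + 2 * Real.pi * w * Complex.I)) ^ (σ : ℂ) * Complex.Gamma σ))) Filter.atTop
      (nhds (∫ w, 𝓕 u w * (Complex.exp (2 * Real.pi * w * x * Complex.I) *
        ((1 / (2 * Real.pi * w * Complex.I)) ^ (σ : ℂ) * Complex.Gamma σ)))) := by
    have hne : ∀ᵐ w : ℝ, w ≠ 0 := by simp [ae_iff]
    refine tendsto_integral_of_dominated_convergence
      (fun w => ‖rlSymbolMul σ (𝓕 u) w‖ * ‖Complex.Gamma σ‖) ?_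
      ((integrable_rlSymbolMul hu' hu0 hσ).norm.mul_const _) ?_ ?_
    · intro n
      have : Measurable fun w : ℝ => Complex.exp (2 * Real.pi * w * x * Complex.I) *
        ((1 / (ε n + 2 * Real.pi * w * Complex.I)) ^ (σ : ℂ) * Complex.Gamma σ) := by fun_prop
      exact hu'.aestronglyMeasurable.mul this.aestronglyMeasurable
    · intro n
      filter_upwards [hne] with w hw
      have h2 : 2 * Real.pi * |w| ≤ ‖(ε n : ℂ) + 2 * Real.pi * w * Complex.I‖ := by
        have := Complex.abs_im_le_norm ((ε n : ℂ) + 2 * Real.pi * w * Complex.I)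
        simpa [abs_mul, abs_of_pos Real.pi_pos] using this
      have hw' : 0 < |w| := abs_pos.mpr hw
      have h3 : ‖(1 / (ε n + 2 * Real.pi * w * Complex.I)) ^ (σ : ℂ)‖ ≤
          ‖(1 / (2 * Real.pi * w * Complex.I)) ^ (σ : ℂ)‖ := by
        rw [Complex.norm_cpow_real, Complex.norm_cpow_real, norm_div, norm_div,
          norm_two_pi_mul_I]
        gcongr
      rw [rlSymbolMul, norm_mul, norm_mul, norm_mul, norm_mul, norm_cexp_two_pi_mul, one_mul,
        mul_comm ‖(1 / (2 * Real.pi * w * Complex.I)) ^ (σ : ℂ)‖, mul_assoc ‖𝓕 u w‖]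
      gcongr
    · filter_upwards [hne] with w hw
      have hz : (2 * Real.pi * w * Complex.I) ≠ 0 := by
        simp [hw, Real.pi_ne_zero]
      -- The limit is purely imaginary and nonzero, hence off the branch cut, where the power is
      -- continuous.
      have hslit : 1 / (2 * Real.pi * w * Complex.I) ∈ Complex.slitPlane := by
        right
        simp [hw, Real.pi_ne_zero, Complex.inv_im]
      have h1 : Filter.Tendsto (fun n => (ε n : ℂ) + 2 * Real.pi * w * Complex.I) Filter.atTop
          (nhds (2 * Real.pi * w * Complex.I)) := by
        simpa using hεc.add_const (2 * Real.pi * w * Complex.I)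
      have h2 := ((tendsto_const_nhds (x := (1 : ℂ))).div h1 hz).cpow
        (tendsto_const_nhds (x := (σ : ℂ))) hslit
      exact ((h2.mul_const _).const_mul _).const_mul _
  have heq := tendsto_nhds_unique hL
    (hR.congr fun n => (integral_mul_dampedKernel hσ0 (hε n) x hu hu').symm)
  have hG : Complex.Gamma σ ≠ 0 := by
    rw [Complex.Gamma_ofReal]
    exact_mod_cast (Real.Gamma_pos_of_pos hσ0).ne'
  rw [rlIntegral, integral_Iic_eq_integral_Iio, ← integral_indicator measurableSet_Iio, heq,
    fourierInv_real_eq_integral, Complex.real_smul, ← integral_const_mul]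
  congr 1 with w
  rw [rlSymbolMul]
  push_cast
  rw [← Complex.Gamma_ofReal]
  field_simp

/-! ### The transform of a derivative, by unit means and differences. -/

/-- The mean of `f` over the unit interval starting at `x`. -/
def unitMean (f : ℝ → ℂ) (x : ℝ) : ℂ :=
  ∫ t in (0 : ℝ)..1, f (x + t)

theorem unitMean_congr_ae {f g : ℝ → ℂ} (h : ∀ᵐ x, f x = g x) : unitMean f = unitMean g := by
  ext x
  refine intervalIntegral.integral_congr_ae ?_
  have h' := (measurePreserving_add_left volume x).quasiMeasurePreserving.ae h
  filter_upwards [h'] with t ht _ using ht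

theorem unitMean_deriv {f : ℝ → ℂ} (hf : Differentiable ℝ f)
    (hf' : ∀ a b, IntervalIntegrable (deriv f) volume a b) :
    unitMean (deriv f) = fwdDiff 1 f := by
  ext x
  rw [unitMean, intervalIntegral.integral_comp_add_left (fun t => deriv f t),
    intervalIntegral.integral_eq_sub_of_hasDerivAt (fun t _ => (hf t).hasDerivAt) (hf' _ _),
    fwdDiff, add_zero]

theorem intervalIntegrable_fwdDiff {f : ℝ → ℂ} (hf : ∀ a b, IntervalIntegrable f volume a b)
    (a b : ℝ) : IntervalIntegrable (fwdDiff 1 f) volume a b := by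
  have h := (hf (a + 1) (b + 1)).comp_add_right 1
  rw [add_sub_cancel_right, add_sub_cancel_right] at h
  exact h.sub (hf a b)

theorem unitMean_fwdDiff {f : ℝ → ℂ} (hf : ∀ a b, IntervalIntegrable f volume a b) :
    unitMean (fwdDiff 1 f) = fwdDiff 1 (unitMean f) := by
  ext x
  have hs : ∀ y : ℝ, IntervalIntegrable (fun t => f (y + t)) volume 0 1 := fun y => by
    have h := (hf (y + 0) (y + 1)).comp_add_left y
    simpa using h
  simp only [unitMean, fwdDiff]
  rw [← intervalIntegral.integral_sub (hs _) (hs _)]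
  congr 1 with t
  rw [add_right_comm]

theorem unitMean_fwdDiff_iterate (n : ℕ) {f : ℝ → ℂ}
    (hf : ∀ a b, IntervalIntegrable f volume a b) :
    unitMean ((fwdDiff 1)^[n] f) = (fwdDiff 1)^[n] (unitMean f) := by
  induction n generalizing f with
  | zero => rfl
  | succ n ih =>
    rw [Function.iterate_succ_apply, Function.iterate_succ_apply,
      ih (intervalIntegrable_fwdDiff hf), unitMean_fwdDiff hf]

/-- Taking the unit mean `n` times turns the `n`-th derivative into the `n`-th difference. -/
theorem unitMean_iterate_iteratedDeriv (n : ℕ) {f : ℝ → ℂ}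
    (hdiff : ∀ k < n, Differentiable ℝ (iteratedDeriv k f))
    (hint : ∀ a b, IntervalIntegrable (iteratedDeriv n f) volume a b) :
    unitMean^[n] (iteratedDeriv n f) = (fwdDiff 1)^[n] f := by
  induction n generalizing f with
  | zero => simp
  | succ n ih =>
    have hd : ∀ k < n, Differentiable ℝ (iteratedDeriv k (deriv f)) := fun k hk => by
      rw [← iteratedDeriv_succ']
      exact hdiff (k + 1) (by omega)
    have hi : ∀ a b, IntervalIntegrable (iteratedDeriv n (deriv f)) volume a b := by
      rwa [← iteratedDeriv_succ']
    have hf : Differentiable ℝ f := by simpa using hdiff 0 (by omega)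
    have hf' : ∀ a b, IntervalIntegrable (deriv f) volume a b := by
      rcases Nat.eq_zero_or_pos n with rfl | hn
      · simpa using hi
      · have : Differentiable ℝ (deriv f) := by simpa using hd 0 hn
        exact fun a b => this.continuous.intervalIntegrable a b
    rw [Function.iterate_succ_apply', iteratedDeriv_succ', ih hd hi,
      unitMean_fwdDiff_iterate n hf', unitMean_deriv hf hf', Function.iterate_succ_apply]

/-- The Fourier multiplier of the unit mean. -/
def unitMeanSymbol (w : ℝ) : ℂ :=
  ∫ t in (0 : ℝ)..1, Complex.exp (2 * Real.pi * w * t * Complex.I)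

theorem unitMeanSymbol_eq_div {w : ℝ} (hw : w ≠ 0) :
    unitMeanSymbol w = (Complex.exp (2 * Real.pi * w * Complex.I) - 1) /
      (2 * Real.pi * w * Complex.I) := by
  have hc : 2 * Real.pi * w * Complex.I ≠ 0 := by simp [hw, Real.pi_ne_zero]
  have := integral_exp_mul_complex (a := 0) (b := 1) hc
  simp only [Complex.ofReal_one, mul_one, Complex.ofReal_zero, mul_zero, Complex.exp_zero] at this
  rw [← this, unitMeanSymbol]
  congr 1 with t
  congr 1
  ring

theorem norm_unitMeanSymbol_le (w : ℝ) : ‖unitMeanSymbol w‖ ≤ 1 := by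
  have := intervalIntegral.norm_integral_le_of_norm_le_const (a := 0) (b := 1) (C := 1)
    (f := fun t : ℝ => Complex.exp (2 * Real.pi * w * t * Complex.I))
    (fun t _ => (norm_cexp_two_pi_mul w t).le)
  simpa [unitMeanSymbol] using this

theorem measurable_unitMeanSymbol : Measurable unitMeanSymbol := by
  refine Continuous.measurable ?_
  exact intervalIntegral.continuous_parametric_intervalIntegral_of_continuous' (by fun_prop) 0 1

theorem integrable_unitMeanSymbol_mul {H : ℝ → ℂ} (hH : Integrable H) :
    Integrable fun w => unitMeanSymbol w * H w :=
  hH.bdd_mul (c := 1) measurable_unitMeanSymbol.aestronglyMeasurable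
    (Filter.Eventually.of_forall norm_unitMeanSymbol_le)

theorem unitMean_fourierInv {H : ℝ → ℂ} (hH : Integrable H) :
    unitMean (𝓕⁻ H) = 𝓕⁻ (fun w => unitMeanSymbol w * H w) := by
  ext x
  rw [unitMean, intervalIntegral.integral_of_le zero_le_one, fourierInv_real_eq_integral]
  simp_rw [fourierInv_real_eq_integral]
  rw [integral_integral_swap]
  · congr 1 with w
    rw [unitMeanSymbol, intervalIntegral.integral_of_le zero_le_one, mul_left_comm,
      ← integral_mul_const]
    congr 1 with t
    have : Complex.exp (2 * Real.pi * w * (x + t : ℝ) * Complex.I) =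
        Complex.exp (2 * Real.pi * w * x * Complex.I) *
          Complex.exp (2 * Real.pi * w * t * Complex.I) := by
      rw [← Complex.exp_add]
      congr 1
      push_cast
      ring
    rw [this]
    ring
  · have h1 : Integrable (fun _ : ℝ => (1 : ℂ)) (volume.restrict (Set.Ioc 0 1)) := by
      simp
    have h2 := h1.mul_prod hH
    simp only [one_mul] at h2
    refine h2.bdd_mul (c := 1) (f := fun p : ℝ × ℝ =>
      Complex.exp (2 * Real.pi * p.2 * ((x + p.1 : ℝ) : ℂ) * Complex.I)) ?_ ?_
    · exact Continuous.aestronglyMeasurable (by fun_prop)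
    · exact Filter.Eventually.of_forall fun p => (norm_cexp_two_pi_mul p.2 (x + p.1)).le

theorem unitMean_iterate_fourierInv (n : ℕ) {H : ℝ → ℂ} (hH : Integrable H) :
    Integrable (fun w => unitMeanSymbol w ^ n * H w) ∧
      unitMean^[n] (𝓕⁻ H) = 𝓕⁻ (fun w => unitMeanSymbol w ^ n * H w) := by
  induction n with
  | zero => simpa using hH
  | succ n ih =>
    have e : (fun w => unitMeanSymbol w ^ (n + 1) * H w) =
        fun w => unitMeanSymbol w * (unitMeanSymbol w ^ n * H w) := by
      ext w; ring
    rw [e, Function.iterate_succ_apply', ih.2]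
    exact ⟨integrable_unitMeanSymbol_mul ih.1, unitMean_fourierInv ih.1⟩

theorem fwdDiff_fourierInv {G : ℝ → ℂ} (hG : Integrable G) :
    Integrable (fun w : ℝ => (Complex.exp (2 * Real.pi * w * Complex.I) - 1) * G w) ∧
    fwdDiff 1 (𝓕⁻ G) =
      𝓕⁻ (fun w : ℝ => (Complex.exp (2 * Real.pi * w * Complex.I) - 1) * G w) := by
  have h1 : Integrable fun w : ℝ => Complex.exp (2 * Real.pi * w * Complex.I) * G w := by
    simpa using integrable_cexp_mul hG 1
  refine ⟨?_, ?_⟩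
  · simp_rw [sub_mul, one_mul]
    exact h1.sub hG
  · ext x
    simp only [fwdDiff]
    rw [fourierInv_real_eq_integral, fourierInv_real_eq_integral, fourierInv_real_eq_integral,
      ← integral_sub (integrable_cexp_mul hG _) (integrable_cexp_mul hG _)]
    congr 1 with w
    have : Complex.exp (2 * Real.pi * w * (x + 1 : ℝ) * Complex.I) =
        Complex.exp (2 * Real.pi * w * x * Complex.I) *
          Complex.exp (2 * Real.pi * w * Complex.I) := by
      rw [← Complex.exp_add]
      congr 1
      push_cast
      ring
    rw [this]
    ring

theorem fwdDiff_iterate_fourierInv (n : ℕ) {G : ℝ → ℂ} (hG : Integrable G) :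
    Integrable (fun w : ℝ => (Complex.exp (2 * Real.pi * w * Complex.I) - 1) ^ n * G w) ∧
    (fwdDiff 1)^[n] (𝓕⁻ G) =
      𝓕⁻ (fun w : ℝ => (Complex.exp (2 * Real.pi * w * Complex.I) - 1) ^ n * G w) := by
  induction n with
  | zero => simpa using hG
  | succ n ih =>
    have e : (fun w : ℝ => (Complex.exp (2 * Real.pi * w * Complex.I) - 1) ^ (n + 1) * G w) =
        fun w : ℝ => (Complex.exp (2 * Real.pi * w * Complex.I) - 1) *
          ((Complex.exp (2 * Real.pi * w * Complex.I) - 1) ^ n * G w) := by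
      ext w; ring
    rw [e, Function.iterate_succ_apply', ih.2]
    exact fwdDiff_fourierInv ih.1

theorem ae_cexp_two_pi_mul_ne_one :
    ∀ᵐ w : ℝ, Complex.exp (2 * Real.pi * w * Complex.I) ≠ 1 := by
  have hc : (Set.range ((↑) : ℤ → ℝ)).Countable := Set.countable_range _
  filter_upwards [hc.ae_notMem volume] with w hw h
  obtain ⟨n, hn⟩ := Complex.exp_eq_one_iff.mp h
  refine hw ⟨n, ?_⟩
  have h2 : (2 * Real.pi * Complex.I : ℂ) ≠ 0 := Complex.two_pi_I_ne_zero
  have : (w : ℂ) = n := mul_right_cancel₀ h2 (by linear_combination hn)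
  exact_mod_cast this.symm

/-- Integration by parts would need control of the intermediate derivatives at infinity. Instead,
`n` unit means turn the derivative into an `n`-th difference of 𝓕⁻ G. Both sides are then inverse
transforms of integrable functions, and injectivity gives an identity of symbols. The mean has
symbol (e^z - 1)/z and the difference e^z - 1, with z = 2πiw, so the common factor cancels off the
integers. -/
theorem fourier_iteratedDeriv_fourierInv {n : ℕ} (hn : n ≠ 0) {G : ℝ → ℂ} (hG : Integrable G)
    (hdiff : ∀ k < n, Differentiable ℝ (iteratedDeriv k (𝓕⁻ G)))
    (hint : Integrable (iteratedDeriv n (𝓕⁻ G)))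
    (hhat : Integrable (𝓕 (iteratedDeriv n (𝓕⁻ G)))) :
    ∀ᵐ w : ℝ, 𝓕 (iteratedDeriv n (𝓕⁻ G)) w = (2 * Real.pi * w * Complex.I) ^ n * G w := by
  have h1 := unitMean_iterate_iteratedDeriv n hdiff fun a b => hint.intervalIntegrable
  have h2 : unitMean^[n] (iteratedDeriv n (𝓕⁻ G)) =
      unitMean^[n] (𝓕⁻ (𝓕 (iteratedDeriv n (𝓕⁻ G)))) := by
    -- One mean is needed to upgrade almost everywhere inversion to an identity of functions; this
    -- is where `n ≠ 0` enters.
    obtain ⟨m, rfl⟩ := Nat.exists_eq_succ_of_ne_zero hn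
    rw [Function.iterate_succ_apply, Function.iterate_succ_apply,
      unitMean_congr_ae (ae_eq_fourierInv_fourier hint hhat)]
  obtain ⟨i3, h3⟩ := unitMean_iterate_fourierInv n hhat
  obtain ⟨i4, h4⟩ := fwdDiff_iterate_fourierInv n hG
  have h5 := ae_eq_of_fourierInv_eq i3 i4 (congrFun (by rw [← h3, ← h2, h1, h4]))
  filter_upwards [h5, ae_cexp_two_pi_mul_ne_one] with w hw hne
  have hw0 : w ≠ 0 := by rintro rfl; simp at hne
  have hc : 2 * Real.pi * w * Complex.I ≠ 0 := by simp [hw0, Real.pi_ne_zero]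
  have hne' := pow_ne_zero n (sub_ne_zero.mpr hne)
  rw [unitMeanSymbol_eq_div hw0, div_pow] at hw
  have hcn := pow_ne_zero n hc
  refine mul_left_cancel₀ hne' ?_
  rw [div_mul_eq_mul_div, div_eq_iff hcn] at hw
  rw [hw]
  ring

theorem iteratedDeriv_fourierInv {N n : ℕ} (hn : n ≤ N) {G : ℝ → ℂ}
    (hG : ∀ k : ℕ, k ≤ N → Integrable fun w : ℝ => w ^ k • G w) :
    iteratedDeriv n (𝓕⁻ G) = 𝓕⁻ (fun w : ℝ => (2 * Real.pi * w * Complex.I) ^ n * G w) := by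
  rw [Real.fourierInv_eq_fourier_comp_neg, Real.fourierInv_eq_fourier_comp_neg,
    Real.iteratedDeriv_fourier (N := N) (n := n) ?_ (by exact_mod_cast hn)]
  · congr 1 with w
    rw [smul_eq_mul]
    congr 2
    push_cast
    ring
  · intro k hk
    have hk' : k ≤ N := by exact_mod_cast hk
    have := ((hG k hk').comp_neg).smul ((-1 : ℝ) ^ k)
    refine this.congr (Filter.Eventually.of_forall fun w => ?_)
    simp only [Pi.smul_apply, smul_smul, ← mul_pow]
    congr 2
    ring

/-! ### Grünwald coefficients: summability and generating function. -/

open Asymptotics Topology Filter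

theorem succ_mul_ringChoose_succ (r : ℝ) (n : ℕ) :
    ((n : ℝ) + 1) * Ring.choose r (n + 1) = (r - n) * Ring.choose r n := by
  have h1 := Ring.descPochhammer_eq_factorial_smul_choose r n
  have h2 := Ring.descPochhammer_eq_factorial_smul_choose r (n + 1)
  rw [descPochhammer_succ_right, Polynomial.smeval_mul, h1] at h2
  simp only [Polynomial.smeval_sub, Polynomial.smeval_X, Polynomial.smeval_natCast, pow_one,
    pow_zero, nsmul_eq_mul, mul_one, Nat.factorial_succ, Nat.cast_mul, Nat.cast_add,
    Nat.cast_one] at h2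
  have hf : (n.factorial : ℝ) ≠ 0 := by exact_mod_cast n.factorial_ne_zero
  refine mul_left_cancel₀ hf ?_
  linear_combination -h2

theorem grunwaldCoeff_succ_mul (r : ℝ) (n : ℕ) :
    ((n : ℝ) + 1) * grunwaldCoeff r (n + 1) = (n - r) * grunwaldCoeff r n := by
  rw [grunwaldCoeff, grunwaldCoeff, pow_succ]
  linear_combination (-(-1 : ℝ) ^ n) * succ_mul_ringChoose_succ r n

theorem grunwaldCoeff_succ_eq_sub (α : ℝ) (n : ℕ) :
    grunwaldCoeff α (n + 1) = grunwaldCoeff (α - 1) (n + 1) - grunwaldCoeff (α - 1) n := by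
  have := Ring.choose_succ_succ (α - 1) n
  rw [sub_add_cancel] at this
  simp only [grunwaldCoeff]
  rw [this, pow_succ]
  ring

theorem grunwaldCoeff_succ_nonpos {r : ℝ} (hr : r ∈ Set.Ioo (0 : ℝ) 1) (n : ℕ) :
    grunwaldCoeff r (n + 1) ≤ 0 := by
  induction n with
  | zero =>
    have := grunwaldCoeff_succ_mul r 0
    simp [grunwaldCoeff] at this ⊢
    linarith [hr.1]
  | succ n ih =>
    have h := grunwaldCoeff_succ_mul r (n + 1)
    have h1 : (0 : ℝ) ≤ ((n + 1 : ℕ) : ℝ) - r := by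
      push_cast; linarith [hr.2, n.cast_nonneg (α := ℝ)]
    have h2 : (0 : ℝ) < ((n + 1 : ℕ) : ℝ) + 1 := by positivity
    have h3 := mul_nonpos_of_nonneg_of_nonpos h1 ih
    by_contra hc
    push Not at hc
    have := mul_pos h2 hc
    linarith

theorem grunwaldCoeff_nonneg {α : ℝ} (hα : α ∈ Set.Ioo (1 : ℝ) 2) (n : ℕ) :
    0 ≤ grunwaldCoeff α (n + 2) := by
  have hr : α - 1 ∈ Set.Ioo (0 : ℝ) 1 := ⟨by linarith [hα.1], by linarith [hα.2]⟩
  have h := grunwaldCoeff_succ_mul (α - 1) (n + 1)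
  have h0 := grunwaldCoeff_succ_nonpos hr n
  rw [grunwaldCoeff_succ_eq_sub]
  push_cast at h
  have h2 : (0 : ℝ) < (n : ℝ) + 1 + 1 := by positivity
  have : ((n : ℝ) + 1 + 1) * (grunwaldCoeff (α - 1) (n + 1 + 1) - grunwaldCoeff (α - 1) (n + 1)) =
      (-α) * grunwaldCoeff (α - 1) (n + 1) := by linear_combination h
  have h3 : 0 ≤ (-α) * grunwaldCoeff (α - 1) (n + 1) :=
    mul_nonneg_of_nonpos_of_nonpos (by linarith [hα.1]) h0
  rw [← this] at h3
  exact nonneg_of_mul_nonneg_right h3 h2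

/-- From index 2 on the coefficients are nonnegative and are successive differences of those of
order α - 1. Their partial sums telescope and are bounded because the latter are nonpositive from
index 1 on. -/
theorem summable_abs_grunwaldCoeff {α : ℝ} (hα : α ∈ Set.Ioo (1 : ℝ) 2) :
    Summable fun k => |grunwaldCoeff α k| := by
  have hr : α - 1 ∈ Set.Ioo (0 : ℝ) 1 := ⟨by linarith [hα.1], by linarith [hα.2]⟩
  rw [← summable_nat_add_iff 2]
  refine summable_of_sum_range_le (c := -grunwaldCoeff (α - 1) 1) (fun _ => abs_nonneg _)
    fun n => ?_
  have h1 : ∀ k, |grunwaldCoeff α (k + 2)| =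
      grunwaldCoeff (α - 1) (k + 1 + 1) - grunwaldCoeff (α - 1) (k + 1) := fun k => by
    rw [abs_of_nonneg (grunwaldCoeff_nonneg hα k), ← grunwaldCoeff_succ_eq_sub]
  simp_rw [h1]
  rw [Finset.sum_range_sub (fun k => grunwaldCoeff (α - 1) (k + 1))]
  linarith [grunwaldCoeff_succ_nonpos hr n]

theorem summable_norm_grunwald {α : ℝ} (hα : α ∈ Set.Ioo (1 : ℝ) 2) {ζ : ℂ} (hζ : ‖ζ‖ ≤ 1) :
    Summable fun k => ‖(grunwaldCoeff α k : ℂ) * ζ ^ k‖ := by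
  refine (summable_abs_grunwaldCoeff hα).of_nonneg_of_le (fun _ => norm_nonneg _) fun k => ?_
  rw [norm_mul, norm_pow, Complex.norm_real, Real.norm_eq_abs]
  exact mul_le_of_le_one_right (abs_nonneg _) (pow_le_one₀ (norm_nonneg _) hζ)

theorem tsum_grunwald_of_norm_lt_one (α : ℝ) {ζ : ℂ} (hζ : ‖ζ‖ < 1) :
    ∑' k, (grunwaldCoeff α k : ℂ) * ζ ^ k = (1 - ζ) ^ (α : ℂ) := by
  have h := (Complex.one_add_cpow_hasFPowerSeriesOnBall_zero (a := (α : ℂ))).hasSum (y := -ζ)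
    (by simpa [enorm_eq_nnnorm, ← NNReal.coe_lt_coe] using hζ)
  rw [zero_add, ← sub_eq_add_neg] at h
  rw [← h.tsum_eq]
  congr 1 with k
  rw [binomialSeries_apply, List.ofFn_const, List.prod_replicate, grunwaldCoeff,
    ← Complex.ofReal_choose, smul_eq_mul, neg_pow]
  push_cast
  ring

/-- Absolute summability of the coefficients carries the binomial series to the unit circle: replace
ζ by rζ and let r → 1 from below. -/
theorem tsum_grunwald {α : ℝ} (hα : α ∈ Set.Ioo (1 : ℝ) 2) {ζ : ℂ} (hζ : ‖ζ‖ ≤ 1)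
    (hs : 1 - ζ ∈ Complex.slitPlane) :
    ∑' k, (grunwaldCoeff α k : ℂ) * ζ ^ k = (1 - ζ) ^ (α : ℂ) := by
  let r : ℕ → ℂ := fun n => ((1 - 1 / ((n : ℝ) + 1) : ℝ) : ℂ)
  have hr : Tendsto r atTop (𝓝 1) := by
    have h1 : Tendsto (fun n : ℕ => 1 - 1 / ((n : ℝ) + 1)) atTop (𝓝 (1 - 0)) :=
      tendsto_const_nhds.sub tendsto_one_div_add_atTop_nhds_zero_nat
    rw [sub_zero] at h1
    have h2 := (Complex.continuous_ofReal.tendsto _).comp h1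
    rwa [Complex.ofReal_one] at h2
  have hr1 : ∀ n, ‖r n‖ < 1 := fun n => by
    have h0 : (0 : ℝ) < 1 / ((n : ℝ) + 1) := by positivity
    have h1 : 1 / ((n : ℝ) + 1) ≤ 1 := by
      rw [div_le_one (by positivity)]
      linarith [n.cast_nonneg (α := ℝ)]
    rw [Complex.norm_real, Real.norm_of_nonneg (by linarith)]
    linarith
  have hrζ : ∀ n, ‖r n * ζ‖ < 1 := fun n => by
    rw [norm_mul]
    exact (mul_le_of_le_one_right (norm_nonneg _) hζ).trans_lt (hr1 n)
  have hrζ' : Tendsto (fun n => r n * ζ) atTop (𝓝 ζ) := by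
    simpa using hr.mul_const ζ
  have hL : Tendsto (fun n => ∑' k, (grunwaldCoeff α k : ℂ) * (r n * ζ) ^ k) atTop
      (𝓝 (∑' k, (grunwaldCoeff α k : ℂ) * ζ ^ k)) := by
    refine tendsto_tsum_of_dominated_convergence (summable_abs_grunwaldCoeff hα)
      (fun k => (hrζ'.pow k).const_mul _) (Eventually.of_forall fun n k => ?_)
    rw [norm_mul, norm_pow, Complex.norm_real, Real.norm_eq_abs]
    exact mul_le_of_le_one_right (abs_nonneg _) (pow_le_one₀ (norm_nonneg _) (hrζ n).le)
  have hR : Tendsto (fun n => (1 - r n * ζ) ^ (α : ℂ)) atTop (𝓝 ((1 - ζ) ^ (α : ℂ))) :=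
    (tendsto_const_nhds.sub hrζ').cpow tendsto_const_nhds hs
  exact tendsto_nhds_unique hL (hR.congr fun n => (tsum_grunwald_of_norm_lt_one α (hrζ n)).symm)

/-! ### The Lubich generating function on the closed disc. -/

/-- The generating function of the Lubich coefficients. -/
def lubichGen (α : ℝ) (ζ : ℂ) : ℂ :=
  ∑' k, (lubichCoeff α k : ℂ) * ζ ^ k

/-- The factorization 3/2 - 2ζ + ζ²/2 = (3/2)(1 - ζ/3)(1 - ζ) makes the coefficients a Cauchy
product; 3^(-m) is absorbed into (ζ/3)^m. -/
theorem lubichCoeff_mul_pow (α : ℝ) (ζ : ℂ) (k : ℕ) :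
    (lubichCoeff α k : ℂ) * ζ ^ k = ((3 / 2 : ℝ) ^ α : ℝ) *
      ∑ m ∈ Finset.range (k + 1), ((grunwaldCoeff α m : ℂ) * (ζ / 3) ^ m) *
        ((grunwaldCoeff α (k - m) : ℂ) * ζ ^ (k - m)) := by
  rw [lubichCoeff]
  push_cast
  rw [mul_assoc, Finset.sum_mul]
  congr 1
  refine Finset.sum_congr rfl fun m hm => ?_
  have hm' : m ≤ k := Nat.lt_succ_iff.mp (Finset.mem_range.mp hm)
  rw [← Nat.sub_add_cancel hm', pow_add, div_pow, Nat.add_sub_cancel_right]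
  have : (3 : ℂ) ^ m ≠ 0 := pow_ne_zero _ (by norm_num)
  field_simp

theorem norm_div_three_le {ζ : ℂ} (hζ : ‖ζ‖ ≤ 1) : ‖ζ / 3‖ < 1 := by
  rw [norm_div, Complex.norm_ofNat]
  linarith

theorem summable_norm_lubichCoeff_mul_pow {α : ℝ} (hα : α ∈ Set.Ioo (1 : ℝ) 2) {ζ : ℂ}
    (hζ : ‖ζ‖ ≤ 1) : Summable fun k => ‖(lubichCoeff α k : ℂ) * ζ ^ k‖ := by
  have h := summable_norm_sum_mul_range_of_summable_norm
    (summable_norm_grunwald hα (norm_div_three_le hζ).le) (summable_norm_grunwald hα hζ)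
  refine (h.mul_left ‖(((3 / 2 : ℝ) ^ α : ℝ) : ℂ)‖).congr fun k => ?_
  rw [lubichCoeff_mul_pow, norm_mul]

theorem summable_abs_lubichCoeff {α : ℝ} (hα : α ∈ Set.Ioo (1 : ℝ) 2) :
    Summable fun k => |lubichCoeff α k| := by
  have := summable_norm_lubichCoeff_mul_pow hα (ζ := 1) (by simp)
  simpa using this

theorem norm_lubichGen_le {α : ℝ} (hα : α ∈ Set.Ioo (1 : ℝ) 2) {ζ : ℂ} (hζ : ‖ζ‖ ≤ 1) :
    ‖lubichGen α ζ‖ ≤ ∑' k, |lubichCoeff α k| := by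
  refine tsum_of_norm_bounded (summable_abs_lubichCoeff hα).hasSum fun k => ?_
  rw [norm_mul, norm_pow, Complex.norm_real, Real.norm_eq_abs]
  exact mul_le_of_le_one_right (abs_nonneg _) (pow_le_one₀ (norm_nonneg _) hζ)

/-- The two arguments lie in [-π/2, π/2] and (-π/2, π/2), so their sum stays in (-π, π) and no
branch jump occurs. The closed bound admits `a` on the imaginary axis. -/
theorem mul_cpow_of_re {a b : ℂ} (ha : a ≠ 0) (ha' : 0 ≤ a.re) (hb : 0 < b.re) (c : ℂ) :
    (a * b) ^ c = a ^ c * b ^ c := by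
  have hb0 : b ≠ 0 := by rintro rfl; simp at hb
  have h1 := abs_le.mp (Complex.abs_arg_le_pi_div_two_iff.mpr ha')
  have h2 := abs_lt.mp (Complex.abs_arg_lt_pi_div_two_iff.mpr (Or.inl hb))
  rw [Complex.cpow_def_of_ne_zero (mul_ne_zero ha hb0), Complex.cpow_def_of_ne_zero ha,
    Complex.cpow_def_of_ne_zero hb0,
    Complex.log_mul ha hb0 ⟨by linarith [h1.1, h2.1], by linarith [h1.2, h2.2]⟩, add_mul,
    Complex.exp_add]

theorem lubichGen_eq {α : ℝ} (hα : α ∈ Set.Ioo (1 : ℝ) 2) {ζ : ℂ} (hζ : ‖ζ‖ ≤ 1)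
    (hs : ζ.re < 1) :
    lubichGen α ζ = (3 / 2 - 2 * ζ + ζ ^ 2 / 2) ^ (α : ℂ) := by
  have hre : 0 < (1 - ζ).re := by simpa using hs
  have h3 := norm_div_three_le hζ
  have hre3 : 0 < (1 - ζ / 3).re := by
    have := Complex.re_le_norm (ζ / 3)
    rw [Complex.sub_re, Complex.one_re]
    linarith
  have h1 : lubichGen α ζ = ((3 / 2 : ℝ) ^ α : ℝ) *
      ((1 - ζ / 3) ^ (α : ℂ) * (1 - ζ) ^ (α : ℂ)) := by
    rw [lubichGen]
    simp_rw [lubichCoeff_mul_pow]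
    rw [tsum_mul_left, ← tsum_mul_tsum_eq_tsum_sum_range_of_summable_norm
      (summable_norm_grunwald hα h3.le) (summable_norm_grunwald hα hζ),
      tsum_grunwald hα hζ (Or.inl hre), tsum_grunwald_of_norm_lt_one α h3]
  have hne : (1 - ζ) ≠ 0 := fun h => by rw [h] at hre; simp at hre
  have h32 : (0 : ℝ) ≤ 3 / 2 := by norm_num
  rw [h1, Complex.ofReal_cpow h32, ← mul_assoc,
    ← mul_cpow_of_re (by norm_num) (by norm_num) hre3, mul_comm,
    ← mul_cpow_of_re hne hre.le]
  · congr 1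
    push_cast
    ring
  · rw [Complex.re_ofReal_mul]
    positivity

/-! ### Taylor expansion of the shifted symbol. -/

/-- The relative error `(3/2 - 2 e^(-z) + e^(-2z)/2) / z - 1`. -/
def lubichRem (z : ℂ) : ℂ :=
  (3 / 2 - 2 * Complex.exp (-z) + Complex.exp (-z) ^ 2 / 2) / z - 1

theorem cexp_mul_sub_isBigO (c : ℂ) (n : ℕ) :
    (fun z : ℂ => Complex.exp (c * z) - ∑ i ∈ Finset.range n, (c * z) ^ i / i.factorial)
      =O[𝓝 0] fun z : ℂ => z ^ n := by
  have ht : Tendsto (fun z : ℂ => c * z) (𝓝 0) (𝓝 0) := by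
    have : Continuous fun z : ℂ => c * z := by fun_prop
    simpa using this.tendsto 0
  refine ((Complex.exp_sub_sum_range_isBigO_pow n).comp_tendsto ht).trans ?_
  simp only [Function.comp_def, mul_pow]
  exact isBigO_const_mul_self _ _ _

/-- The numerator is z - z³/3 + z⁴/4 + O(z⁵); division by z costs one order, so the exponentials are
expanded with five terms. -/
theorem lubichRem_isBigO :
    (fun z : ℂ => lubichRem z - (-(z ^ 2) / 3 + z ^ 3 / 4)) =O[𝓝[≠] 0] fun z : ℂ => z ^ 4 := by
  have h1 := (cexp_mul_sub_isBigO (-1) 5).const_mul_left (-2)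
  have h2 := (cexp_mul_sub_isBigO (-2) 5).const_mul_left (1 / 2)
  have h3 := (h1.add h2).mono (nhdsWithin_le_nhds (s := {0}ᶜ))
  have h4 := (isBigO_refl (fun z : ℂ => z⁻¹) (𝓝[≠] 0)).mul h3
  refine h4.congr' ?_ ?_
  · filter_upwards [self_mem_nhdsWithin] with z hz
    have hz' : z ≠ 0 := hz
    have e2 : Complex.exp (-2 * z) = Complex.exp (-z) ^ 2 := by
      rw [← Complex.exp_nat_mul]
      congr 1
      push_cast
      ring
    rw [lubichRem, e2, neg_one_mul]
    simp only [Finset.sum_range_succ, Finset.sum_range_zero, Nat.factorial]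
    push_cast
    field_simp
    ring
  · filter_upwards [self_mem_nhdsWithin] with z hz
    have hz' : z ≠ 0 := hz
    field_simp

theorem pow_isBigO_pow_of_le {m n : ℕ} (h : n ≤ m) :
    (fun z : ℂ => z ^ m) =O[𝓝[≠] 0] fun z : ℂ => z ^ n := by
  obtain ⟨k, rfl⟩ := Nat.exists_eq_add_of_le h
  have h1 : (fun z : ℂ => z ^ k) =O[𝓝[≠] 0] fun _ => (1 : ℂ) :=
    (((continuous_pow k).tendsto (0 : ℂ)).mono_left nhdsWithin_le_nhds).isBigO_one ℂ
  simpa [pow_add] using (isBigO_refl (fun z : ℂ => z ^ n) (𝓝[≠] 0)).mul h1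

theorem lubichRem_isBigO_sq : lubichRem =O[𝓝[≠] 0] fun z : ℂ => z ^ 2 := by
  have h1 := lubichRem_isBigO.trans (pow_isBigO_pow_of_le (by norm_num : 2 ≤ 4))
  have h2 : (fun z : ℂ => -(z ^ 2) / 3 + z ^ 3 / 4) =O[𝓝[≠] 0] fun z : ℂ => z ^ 2 := by
    refine ((((isBigO_refl (fun z : ℂ => z ^ 2) (𝓝[≠] 0)).const_mul_left (-1 / 3)).add
      ((pow_isBigO_pow_of_le (by norm_num : 2 ≤ 3)).const_mul_left (1 / 4))).congr_left ?_)
    intro z; ring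
  simpa using h1.add h2

theorem tendsto_lubichRem : Tendsto lubichRem (𝓝[≠] 0) (𝓝 0) := by
  refine lubichRem_isBigO_sq.trans_tendsto ?_
  have := ((continuous_pow 2).tendsto (0 : ℂ)).mono_left (nhdsWithin_le_nhds (s := {0}ᶜ))
  simpa using this

theorem one_add_cpow_sub_isBigO (a : ℂ) :
    (fun z : ℂ => (1 + z) ^ a - (1 + a * z)) =O[𝓝 0] fun z : ℂ => z ^ 2 := by
  have h := (Complex.one_add_cpow_hasFPowerSeriesAt_zero (a := a)).isBigO_sub_partialSum_pow 2
  have h2 : (fun z : ℂ => (1 + z) ^ a - (1 + a * z)) =O[𝓝 0] fun z : ℂ => ‖z‖ ^ 2 := by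
    refine h.congr_left fun z => ?_
    simp only [FormalMultilinearSeries.partialSum, Finset.sum_range_succ, Finset.sum_range_zero,
      binomialSeries_apply, List.ofFn_const, List.prod_replicate, Ring.choose_one_right,
      Ring.choose_zero_right, smul_eq_mul, zero_add]
    ring
  refine h2.trans (IsBigO.of_norm_right ?_)
  simp only [norm_pow]
  exact isBigO_refl _ _

theorem one_add_lubichRem_cpow_isBigO (a : ℂ) :
    (fun z : ℂ => (1 + lubichRem z) ^ a - (1 - a / 3 * z ^ 2 + a / 4 * z ^ 3)) =O[𝓝[≠] 0]
      fun z : ℂ => z ^ 4 := by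
  have h1 : (fun z : ℂ => (1 + lubichRem z) ^ a - (1 + a * lubichRem z)) =O[𝓝[≠] 0]
      fun z : ℂ => z ^ 4 := by
    refine ((one_add_cpow_sub_isBigO a).comp_tendsto tendsto_lubichRem).trans ?_
    refine (lubichRem_isBigO_sq.pow 2).congr_right fun z => ?_
    ring
  refine (h1.add (lubichRem_isBigO.const_mul_left a)).congr_left fun z => ?_
  ring

theorem tendsto_one_add_lubichRem_cpow (a : ℂ) :
    Tendsto (fun z => (1 + lubichRem z) ^ a) (𝓝[≠] 0) (𝓝 1) := by
  have h1 : Tendsto (fun z => 1 + lubichRem z) (𝓝[≠] 0) (𝓝 1) := by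
    simpa using tendsto_lubichRem.const_add 1
  have := h1.cpow (tendsto_const_nhds (x := a)) (by simp)
  simpa using this

theorem shifted_symbol_isBigO (a p : ℂ) :
    (fun z : ℂ => Complex.exp (p * z) * (1 + lubichRem z) ^ a -
      (1 + p * z + (p ^ 2 / 2 - a / 3) * z ^ 2 + (p ^ 3 / 6 - a * p / 3 + a / 4) * z ^ 3))
      =O[𝓝[≠] 0] fun z : ℂ => z ^ 4 := by
  have h1 : (fun z : ℂ => Complex.exp (p * z) -
      ∑ i ∈ Finset.range 4, (p * z) ^ i / i.factorial) =O[𝓝[≠] 0] fun z : ℂ => z ^ 4 :=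
    (cexp_mul_sub_isBigO p 4).mono nhdsWithin_le_nhds
  have h2 := h1.mul ((tendsto_one_add_lubichRem_cpow a).isBigO_one ℂ)
  have hb : ∀ {g : ℂ → ℂ}, Continuous g → g =O[𝓝[≠] 0] fun _ => (1 : ℂ) := fun hg =>
    ((hg.tendsto 0).mono_left nhdsWithin_le_nhds).isBigO_one ℂ
  have h3 := (one_add_lubichRem_cpow_isBigO a).mul
    (hb (g := fun z => ∑ i ∈ Finset.range 4, (p * z) ^ i / i.factorial) (by fun_prop))
  -- The product of the two cubic Taylor polynomials has terms of degree 4 to 6; the bracket is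
  -- their sum divided by z⁴.
  have h4 := (isBigO_refl (fun z : ℂ => z ^ 4) (𝓝[≠] 0)).mul
    (hb (g := fun z => (p * a / 4 - p ^ 2 / 2 * (a / 3)) + (p ^ 2 / 2 * (a / 4) -
      p ^ 3 / 6 * (a / 3)) * z + p ^ 3 / 6 * (a / 4) * z ^ 2) (by fun_prop))
  simp only [mul_one] at h2 h3 h4
  refine ((h2.add h3).add h4).congr_left fun z => ?_
  simp only [Finset.sum_range_succ, Finset.sum_range_zero, Nat.factorial]
  push_cast
  ring

/-! ### Moment conditions and the global symbol estimate. -/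

/-- The weights `c` of a combination of shifted Lubich operators cancel the error terms of order
less than four. -/
structure FourthOrderWeights (α : ℝ) (c : ℤ →₀ ℝ) : Prop where
  zero : c.sum (fun _ a => a) = 1
  one : c.sum (fun p a => a * (p : ℝ)) = 0
  two : c.sum (fun p a => a * (p : ℝ) ^ 2) = 2 / 3 * α
  three : c.sum (fun p a => a * (p : ℝ) ^ 3) = -(3 / 2) * α

/-- With moments m₀, ..., m₃ the coefficients of z² and z³ are m₂/2 - αm₀/3 and m₃/6 - αm₁/3 +
αm₀/4. They vanish for the prescribed moments. -/
theorem FourthOrderWeights.isBigO {α : ℝ} {c : ℤ →₀ ℝ} (hc : FourthOrderWeights α c) :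
    (fun z : ℂ => c.sum (fun p a => (a : ℂ) *
      (Complex.exp (p * z) * (1 + lubichRem z) ^ (α : ℂ))) - 1) =O[𝓝[≠] 0]
      fun z : ℂ => z ^ 4 := by
  have h : (fun z : ℂ => ∑ p ∈ c.support, (c p : ℂ) *
      (Complex.exp (p * z) * (1 + lubichRem z) ^ (α : ℂ) -
      (1 + p * z + ((p : ℂ) ^ 2 / 2 - α / 3) * z ^ 2 +
        ((p : ℂ) ^ 3 / 6 - α * p / 3 + α / 4) * z ^ 3))) =O[𝓝[≠] 0] fun z : ℂ => z ^ 4 :=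
    IsBigO.fun_sum fun p _ => (shifted_symbol_isBigO (α : ℂ) (p : ℂ)).const_mul_left _
  refine h.congr_left fun z => ?_
  have c0 : ∑ p ∈ c.support, (c p : ℂ) = 1 := by exact_mod_cast hc.zero
  have c1 : ∑ p ∈ c.support, (c p : ℂ) * p = 0 := by exact_mod_cast hc.one
  have c2 : ∑ p ∈ c.support, (c p : ℂ) * (p : ℂ) ^ 2 = 2 / 3 * α := by
    have := congrArg ((↑) : ℝ → ℂ) hc.two
    simpa [Finsupp.sum] using this
  have c3 : ∑ p ∈ c.support, (c p : ℂ) * (p : ℂ) ^ 3 = -(3 / 2) * α := by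
    have := congrArg ((↑) : ℝ → ℂ) hc.three
    simpa [Finsupp.sum] using this
  have hpoly : ∑ p ∈ c.support, (c p : ℂ) * (1 + p * z + ((p : ℂ) ^ 2 / 2 - α / 3) * z ^ 2 +
        ((p : ℂ) ^ 3 / 6 - α * p / 3 + α / 4) * z ^ 3) = 1 := by
    have e : ∀ p ∈ c.support, (c p : ℂ) * (1 + p * z + ((p : ℂ) ^ 2 / 2 - α / 3) * z ^ 2 +
        ((p : ℂ) ^ 3 / 6 - α * p / 3 + α / 4) * z ^ 3) =
        (c p : ℂ) * (1 - α / 3 * z ^ 2 + α / 4 * z ^ 3) + (c p : ℂ) * p * (z - α / 3 * z ^ 3) +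
        (c p : ℂ) * (p : ℂ) ^ 2 * (z ^ 2 / 2) + (c p : ℂ) * (p : ℂ) ^ 3 * (z ^ 3 / 6) :=
      fun p _ => by ring
    rw [Finset.sum_congr rfl e, Finset.sum_add_distrib, Finset.sum_add_distrib,
      Finset.sum_add_distrib, ← Finset.sum_mul, ← Finset.sum_mul, ← Finset.sum_mul,
      ← Finset.sum_mul, c0, c1, c2, c3]
    ring
  simp_rw [mul_sub]
  rw [Finset.sum_sub_distrib, hpoly, Finsupp.sum]

/-- The symbol of the combination with weights `c` of shifted Lubich operators with step one. -/
def lubichSymbol (α : ℝ) (c : ℤ →₀ ℝ) (y : ℝ) : ℂ :=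
  c.sum fun p a => (a : ℂ) * (Complex.exp (p * (y * Complex.I)) *
    lubichGen α (Complex.exp (-(y * Complex.I))))

theorem norm_cexp_neg_ofReal_mul_I (y : ℝ) : ‖Complex.exp (-(y * Complex.I))‖ = 1 := by
  have := Complex.norm_exp_ofReal_mul_I (-y)
  push_cast at this
  rwa [neg_mul] at this

theorem norm_cexp_int_mul_ofReal_mul_I (p : ℤ) (y : ℝ) :
    ‖Complex.exp (p * (y * Complex.I))‖ = 1 := by
  have := Complex.norm_exp_ofReal_mul_I (p * y)
  push_cast at this
  rwa [mul_assoc] at this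

theorem norm_lubichSymbol_le {α : ℝ} (hα : α ∈ Set.Ioo (1 : ℝ) 2) (c : ℤ →₀ ℝ) :
    ∃ K, 0 ≤ K ∧ ∀ y, ‖lubichSymbol α c y‖ ≤ K := by
  have h0 : 0 ≤ ∑' k, |lubichCoeff α k| := tsum_nonneg fun _ => abs_nonneg _
  refine ⟨∑ p ∈ c.support, |c p| * ∑' k, |lubichCoeff α k|, by positivity, fun y => ?_⟩
  rw [lubichSymbol, Finsupp.sum]
  refine (norm_sum_le _ _).trans (Finset.sum_le_sum fun p _ => ?_)
  rw [norm_mul, norm_mul, norm_cexp_int_mul_ofReal_mul_I, one_mul, Complex.norm_real,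
    Real.norm_eq_abs]
  gcongr
  exact norm_lubichGen_le hα (norm_cexp_neg_ofReal_mul_I y).le

theorem lubichGen_cexp_neg {α : ℝ} (hα : α ∈ Set.Ioo (1 : ℝ) 2) {y : ℝ} (hy : y ≠ 0)
    (hy1 : |y| < 1) (hre : 0 < (1 + lubichRem (y * Complex.I)).re) :
    lubichGen α (Complex.exp (-(y * Complex.I))) =
      (y * Complex.I) ^ (α : ℂ) * (1 + lubichRem (y * Complex.I)) ^ (α : ℂ) := by
  have hz : (y : ℂ) * Complex.I ≠ 0 := by simp [hy]
  have hcos : (Complex.exp (-(y * Complex.I))).re < 1 := by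
    have h1 : Complex.exp (-(y * Complex.I)) = Complex.exp ((-y : ℝ) * Complex.I) := by
      push_cast; rw [neg_mul]
    rw [h1, Complex.exp_ofReal_mul_I_re, Real.cos_neg]
    -- The bound |y| < 1 < 2π leaves y = 0 as the only zero of 1 - cos y.
    refine (Real.cos_le_one y).lt_of_ne fun h => hy ?_
    have hb := abs_lt.mp hy1
    have hpi := Real.pi_gt_three
    exact (Real.cos_eq_one_iff_of_lt_of_lt (by linarith) (by linarith)).mp h
  rw [lubichGen_eq hα (norm_cexp_neg_ofReal_mul_I y).le hcos,
    ← mul_cpow_of_re hz (by simp) hre, lubichRem, add_sub_cancel,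
    mul_div_cancel₀ _ hz]

theorem FourthOrderWeights.norm_symbol_sub_le {α : ℝ} (hα : α ∈ Set.Ioo (1 : ℝ) 2)
    {c : ℤ →₀ ℝ} (hc : FourthOrderWeights α c) :
    ∃ C, ∀ y : ℝ, y ≠ 0 →
      ‖(y * Complex.I) ^ (α : ℂ) - lubichSymbol α c y‖ ≤ C * |y| ^ (α + 4) := by
  obtain ⟨C₁, hC₁⟩ := hc.isBigO.bound
  have hre : ∀ᶠ z in 𝓝[≠] (0 : ℂ), 0 < (1 + lubichRem z).re := by
    have h1 : Tendsto (fun z => (1 + lubichRem z).re) (𝓝[≠] 0) (𝓝 (1 + 0 : ℂ).re) :=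
      (Complex.continuous_re.tendsto _).comp (tendsto_lubichRem.const_add 1)
    exact h1.eventually_const_lt (by simp)
  obtain ⟨δ, hδ, hball⟩ := Metric.mem_nhdsWithin_iff.mp (hC₁.and hre)
  obtain ⟨K, hK0, hK⟩ := norm_lubichSymbol_le hα c
  let η := min δ 1
  have hη : 0 < η := lt_min hδ one_pos
  have hα0 : 0 < α + 4 := by linarith [hα.1]
  have hpow : ∀ y : ℝ, ‖(y * Complex.I) ^ (α : ℂ)‖ = |y| ^ α := fun y => by
    rw [Complex.norm_cpow_real]; simp
  -- `C₁` serves |y| < η, by the expansion. For |y| ≥ η the symbol bound `K` and |y|^α are each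
  -- absorbed into |y|^(α+4) at the cost of a negative power of η.
  refine ⟨max C₁ (K * η ^ (-(α + 4)) + η ^ (-4 : ℝ)), fun y hy => ?_⟩
  have hy0 : 0 < |y| := abs_pos.mpr hy
  rcases lt_or_ge |y| η with h | h
  · have hmem : (y * Complex.I : ℂ) ∈ Metric.ball 0 δ ∩ {0}ᶜ := by
      refine ⟨?_, by simp [hy]⟩
      simpa using h.trans_le (min_le_left _ _)
    obtain ⟨hb1, hb2⟩ := hball hmem
    have e : lubichSymbol α c y = (y * Complex.I) ^ (α : ℂ) *
        c.sum (fun p a => (a : ℂ) * (Complex.exp (p * (y * Complex.I)) *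
          (1 + lubichRem (y * Complex.I)) ^ (α : ℂ))) := by
      rw [lubichSymbol, Finsupp.mul_sum,
        lubichGen_cexp_neg hα hy (h.trans_le (min_le_right _ _)) hb2]
      refine Finsupp.sum_congr fun p _ => ?_
      ring
    have e2 : ∀ s : ℂ, (y * Complex.I) ^ (α : ℂ) - (y * Complex.I) ^ (α : ℂ) * s =
        -((y * Complex.I) ^ (α : ℂ) * (s - 1)) := fun s => by ring
    rw [e, e2, norm_neg, norm_mul, hpow, Real.rpow_add hy0]
    have h4 : |y| ^ (4 : ℝ) = |y| ^ 4 := by exact_mod_cast Real.rpow_natCast |y| 4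
    have hn : ‖(y * Complex.I : ℂ) ^ 4‖ = |y| ^ 4 := by rw [norm_pow]; simp
    rw [hn] at hb1
    rw [h4]
    calc _ ≤ |y| ^ α * (C₁ * |y| ^ 4) := by gcongr
      _ = C₁ * (|y| ^ α * |y| ^ 4) := by ring
      _ ≤ _ := by gcongr; exact le_max_left _ _
  · have h1 : 1 ≤ η ^ (-(α + 4)) * |y| ^ (α + 4) := by
      rw [Real.rpow_neg hη.le, ← div_eq_inv_mul, one_le_div (by positivity)]
      gcongr
    have h2 : |y| ^ α ≤ η ^ (-4 : ℝ) * |y| ^ (α + 4) := by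
      have : 1 ≤ η ^ (-4 : ℝ) * |y| ^ (4 : ℝ) := by
        rw [Real.rpow_neg hη.le, ← div_eq_inv_mul, one_le_div (by positivity)]
        gcongr
      rw [Real.rpow_add hy0, mul_left_comm]
      exact le_mul_of_one_le_right (by positivity) this
    calc _ ≤ ‖(y * Complex.I) ^ (α : ℂ)‖ + ‖lubichSymbol α c y‖ := norm_sub_le _ _
      _ ≤ |y| ^ α + K := by rw [hpow]; gcongr; exact hK y
      _ ≤ η ^ (-4 : ℝ) * |y| ^ (α + 4) + K * (η ^ (-(α + 4)) * |y| ^ (α + 4)) := by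
        gcongr
        exact le_mul_of_one_le_right hK0 h1
      _ = (K * η ^ (-(α + 4)) + η ^ (-4 : ℝ)) * |y| ^ (α + 4) := by ring
      _ ≤ _ := by gcongr; exact le_max_right _ _

/-! ### Moments of the weights. -/

/-- The weights of `wsldOp2`. -/
def wsldWeights2 (p q : ℤ) : ℤ →₀ ℝ :=
  Finsupp.single p ((q : ℝ) / ((q : ℝ) - (p : ℝ))) +
    Finsupp.single q ((p : ℝ) / ((p : ℝ) - (q : ℝ)))

/-- The weights of `wsldOp3`. -/
def wsldWeights3 (α : ℝ) (p q r s : ℤ) : ℤ →₀ ℝ :=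
  weight3 α p q r s • wsldWeights2 p q + weight3 α r s p q • wsldWeights2 r s

/-- The weights of `wsldOp4`. -/
def wsldWeights4 (α : ℝ) (p q r s p' q' r' s' : ℤ) : ℤ →₀ ℝ :=
  (coeffA p q r s * coeffB α p' q' r' s' /
      (coeffA p q r s * coeffB α p' q' r' s' - coeffA p' q' r' s' * coeffB α p q r s)) •
    wsldWeights3 α p q r s +
  (coeffA p' q' r' s' * coeffB α p q r s /
      (coeffA p' q' r' s' * coeffB α p q r s - coeffA p q r s * coeffB α p' q' r' s')) •
    wsldWeights3 α p' q' r' s'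

theorem linearCombination_wsldWeights2 {E : Type*} [AddCommGroup E] [Module ℝ E] (f : ℤ → E)
    (p q : ℤ) : Finsupp.linearCombination ℝ f (wsldWeights2 p q) =
      ((q : ℝ) / ((q : ℝ) - (p : ℝ))) • f p + ((p : ℝ) / ((p : ℝ) - (q : ℝ))) • f q := by
  rw [wsldWeights2, map_add, Finsupp.linearCombination_single, Finsupp.linearCombination_single]

theorem linearCombination_wsldWeights3 {E : Type*} [AddCommGroup E] [Module ℝ E] (f : ℤ → E)
    (α : ℝ) (p q r s : ℤ) : Finsupp.linearCombination ℝ f (wsldWeights3 α p q r s) =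
      weight3 α p q r s • Finsupp.linearCombination ℝ f (wsldWeights2 p q) +
        weight3 α r s p q • Finsupp.linearCombination ℝ f (wsldWeights2 r s) := by
  rw [wsldWeights3, map_add, map_smul, map_smul]

/-- Finitely supported weights add up automatically when some of the eight shifts coincide, so no
case distinction is needed. -/
theorem wsldOp4_eq_sum (α h : ℝ) (p q r s p' q' r' s' : ℤ) (u : ℝ → ℂ) (x : ℝ) :
    wsldOp4 α h p q r s p' q' r' s' u x =
      (wsldWeights4 α p q r s p' q' r' s').sum fun p a => a • lubichOp α h p u x := by
  rw [← Finsupp.linearCombination_apply, wsldWeights4, map_add, map_smul, map_smul,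
    linearCombination_wsldWeights3, linearCombination_wsldWeights3,
    linearCombination_wsldWeights2, linearCombination_wsldWeights2,
    linearCombination_wsldWeights2, linearCombination_wsldWeights2]
  rfl

theorem wsldWeights2_moments {p q : ℤ} (hpq : p ≠ q) :
    Finsupp.linearCombination ℝ (fun _ => (1 : ℝ)) (wsldWeights2 p q) = 1 ∧
    Finsupp.linearCombination ℝ (fun k : ℤ => (k : ℝ)) (wsldWeights2 p q) = 0 ∧
    Finsupp.linearCombination ℝ (fun k : ℤ => (k : ℝ) ^ 2) (wsldWeights2 p q) = -(p * q) ∧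
    Finsupp.linearCombination ℝ (fun k : ℤ => (k : ℝ) ^ 3) (wsldWeights2 p q) =
      -(p * q * (p + q)) := by
  have h1 : (p : ℝ) - q ≠ 0 := sub_ne_zero.mpr (by exact_mod_cast hpq)
  have h2 : (q : ℝ) - p ≠ 0 := sub_ne_zero.mpr (by exact_mod_cast hpq.symm)
  simp only [linearCombination_wsldWeights2, smul_eq_mul]
  have e : (p : ℝ) / (p - q) = -(p / (q - p)) := by rw [← neg_sub (q : ℝ), div_neg]
  rw [e]
  refine ⟨?_, ?_, ?_, ?_⟩ <;> field_simp <;> ring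

/-- The weights are tuned to the second moment; the third misses its target -3α/2 by b/(6a), which
is the origin of a and b. -/
theorem wsldWeights3_moments (α : ℝ) {p q r s : ℤ} (hpq : p ≠ q) (hrs : r ≠ s)
    (hpqrs : r * s ≠ p * q) :
    Finsupp.linearCombination ℝ (fun _ => (1 : ℝ)) (wsldWeights3 α p q r s) = 1 ∧
    Finsupp.linearCombination ℝ (fun k : ℤ => (k : ℝ)) (wsldWeights3 α p q r s) = 0 ∧
    Finsupp.linearCombination ℝ (fun k : ℤ => (k : ℝ) ^ 2) (wsldWeights3 α p q r s) =
      2 / 3 * α ∧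
    Finsupp.linearCombination ℝ (fun k : ℤ => (k : ℝ) ^ 3) (wsldWeights3 α p q r s) =
      coeffB α p q r s / (6 * coeffA p q r s) - 3 / 2 * α := by
  have h1 : (r : ℝ) * s - p * q ≠ 0 := sub_ne_zero.mpr (by exact_mod_cast hpqrs)
  obtain ⟨a0, a1, a2, a3⟩ := wsldWeights2_moments hpq
  obtain ⟨b0, b1, b2, b3⟩ := wsldWeights2_moments hrs
  have e : weight3 α r s p q =
      -((3 * (p : ℝ) * q + 2 * α) / (3 * ((r : ℝ) * s - p * q))) := by
    rw [weight3, ← neg_sub ((r : ℝ) * s), mul_neg, div_neg]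
  simp only [linearCombination_wsldWeights3, a0, a1, a2, a3, b0, b1, b2, b3, smul_eq_mul, e]
  rw [weight3, coeffA, coeffB]
  refine ⟨?_, ?_, ?_, ?_⟩
  · field_simp; ring
  · ring
  · field_simp; ring
  · field_simp; ring

/-- The two weights are proportional to ab' and -a'b, so the defects b/(6a) and b'/(6a') of the
third moment cancel, while the lower moments, common to both families, are preserved. -/
theorem fourthOrderWeights_wsldWeights4 (α : ℝ) {p q r s p' q' r' s' : ℤ}
    (hpq : p ≠ q) (hrs : r ≠ s) (hpqrs : r * s ≠ p * q)
    (hpq' : p' ≠ q') (hrs' : r' ≠ s') (hpqrs' : r' * s' ≠ p' * q')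
    (hab : coeffA p q r s * coeffB α p' q' r' s' ≠ coeffA p' q' r' s' * coeffB α p q r s) :
    FourthOrderWeights α (wsldWeights4 α p q r s p' q' r' s') := by
  have hA : coeffA p q r s ≠ 0 := sub_ne_zero.mpr (by exact_mod_cast hpqrs)
  have hA' : coeffA p' q' r' s' ≠ 0 := sub_ne_zero.mpr (by exact_mod_cast hpqrs')
  obtain ⟨a0, a1, a2, a3⟩ := wsldWeights3_moments α hpq hrs hpqrs
  obtain ⟨b0, b1, b2, b3⟩ := wsldWeights3_moments α hpq' hrs' hpqrs'
  have hd := sub_ne_zero.mpr hab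
  have key : ∀ f : ℤ → ℝ, (wsldWeights4 α p q r s p' q' r' s').sum (fun k a => a * f k) =
      (coeffA p q r s * coeffB α p' q' r' s' *
        Finsupp.linearCombination ℝ f (wsldWeights3 α p q r s) -
      coeffA p' q' r' s' * coeffB α p q r s *
        Finsupp.linearCombination ℝ f (wsldWeights3 α p' q' r' s')) /
      (coeffA p q r s * coeffB α p' q' r' s' - coeffA p' q' r' s' * coeffB α p q r s) := by
    intro f
    have : (wsldWeights4 α p q r s p' q' r' s').sum (fun k a => a * f k) =
        Finsupp.linearCombination ℝ f (wsldWeights4 α p q r s p' q' r' s') := by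
      rw [Finsupp.linearCombination_apply]; rfl
    rw [this, wsldWeights4, map_add, map_smul, map_smul, smul_eq_mul, smul_eq_mul,
      ← neg_sub (coeffA p q r s * coeffB α p' q' r' s'), div_neg]
    ring
  have k0 := key fun _ => 1
  simp only [mul_one] at k0
  constructor
  · rw [k0, a0, b0, mul_one, mul_one, div_self hd]
  · rw [key, a1, b1]; simp
  · rw [key, a2, b2, div_eq_iff hd]; ring
  · rw [key, a3, b3, div_eq_iff hd]
    field_simp
    ring

/-! ### Lubich operators as Fourier multipliers. -/

theorem continuous_lubichGen_cexp {α : ℝ} (hα : α ∈ Set.Ioo (1 : ℝ) 2) :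
    Continuous fun y : ℝ => lubichGen α (Complex.exp (-(y * Complex.I))) := by
  refine continuous_tsum (fun k => by fun_prop) (summable_abs_lubichCoeff hα) fun k y => ?_
  rw [norm_mul, norm_pow, norm_cexp_neg_ofReal_mul_I, one_pow, mul_one, Complex.norm_real,
    Real.norm_eq_abs]

theorem summable_lubichCoeff_smul {α : ℝ} (hα : α ∈ Set.Ioo (1 : ℝ) 2) {v : ℝ → ℂ} {M : ℝ}
    (hv : ∀ x, ‖v x‖ ≤ M) (t : ℕ → ℝ) : Summable fun k => lubichCoeff α k • v (t k) := by
  refine Summable.of_norm_bounded ((summable_abs_lubichCoeff hα).mul_right M) fun k => ?_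
  rw [norm_smul, Real.norm_eq_abs]
  gcongr
  exact hv _

theorem integrable_cexp_mul_lubichGen_mul {α : ℝ} (hα : α ∈ Set.Ioo (1 : ℝ) 2) {f : ℝ → ℂ}
    (hf : Integrable f) (h : ℝ) (p : ℤ) (x : ℝ) :
    Integrable fun w : ℝ => Complex.exp (2 * Real.pi * w * x * Complex.I) *
      (Complex.exp (p * ((2 * Real.pi * w * h : ℝ) * Complex.I)) *
        lubichGen α (Complex.exp (-((2 * Real.pi * w * h : ℝ) * Complex.I))) * f w) := by
  refine integrable_cexp_mul ?_ x
  refine hf.bdd_mul (c := ∑' k, |lubichCoeff α k|) ?_ (Eventually.of_forall fun w => ?_)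
  · have := (continuous_lubichGen_cexp hα).comp (by fun_prop : Continuous fun w : ℝ =>
      2 * Real.pi * w * h)
    exact (Continuous.mul (by fun_prop) this).aestronglyMeasurable
  · rw [norm_mul, norm_cexp_int_mul_ofReal_mul_I, one_mul]
    exact norm_lubichGen_le hα (norm_cexp_neg_ofReal_mul_I _).le

/-- A translation by (k - p)h multiplies the transform by e^(ipy) (e^(-iy))^k with y = 2πwh. Sum and
integral commute because the coefficients are absolutely summable and `f` is integrable. -/
theorem tsum_lubichCoeff_smul_fourierInv {α : ℝ} (hα : α ∈ Set.Ioo (1 : ℝ) 2) {f : ℝ → ℂ}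
    (hf : Integrable f) (h : ℝ) (p : ℤ) (x : ℝ) :
    ∑' k : ℕ, lubichCoeff α k • 𝓕⁻ f (x - ((k : ℝ) - (p : ℝ)) * h) =
      ∫ w : ℝ, Complex.exp (2 * Real.pi * w * x * Complex.I) *
        (Complex.exp (p * ((2 * Real.pi * w * h : ℝ) * Complex.I)) *
          lubichGen α (Complex.exp (-((2 * Real.pi * w * h : ℝ) * Complex.I))) * f w) := by
  let F : ℕ → ℝ → ℂ := fun k w => (lubichCoeff α k : ℂ) *
    (Complex.exp (2 * Real.pi * w * (x - ((k : ℝ) - (p : ℝ)) * h : ℝ) * Complex.I) * f w)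
  have hF : ∀ k, Integrable (F k) := fun k => (integrable_cexp_mul hf _).const_mul _
  have hFn : ∀ k, ∫ w, ‖F k w‖ = |lubichCoeff α k| * ∫ w, ‖f w‖ := fun k => by
    rw [← integral_const_mul]
    congr 1 with w
    rw [norm_mul, norm_mul, norm_cexp_two_pi_mul, one_mul, Complex.norm_real, Real.norm_eq_abs]
  have hs := hasSum_integral_of_summable_integral_norm hF (by
    simp_rw [hFn]
    exact (summable_abs_lubichCoeff hα).mul_right _)
  have hl : ∀ k, ∫ w, F k w = lubichCoeff α k • 𝓕⁻ f (x - ((k : ℝ) - (p : ℝ)) * h) := fun k => by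
    rw [fourierInv_real_eq_integral, integral_const_mul, Complex.real_smul]
  simp_rw [hl] at hs
  rw [hs.tsum_eq]
  congr 1 with w
  rw [lubichGen, ← tsum_mul_left, ← tsum_mul_right, ← tsum_mul_left]
  congr 1 with k
  have e : Complex.exp (2 * Real.pi * w * (x - ((k : ℝ) - (p : ℝ)) * h : ℝ) * Complex.I) =
      Complex.exp (2 * Real.pi * w * x * Complex.I) *
      (Complex.exp (p * ((2 * Real.pi * w * h : ℝ) * Complex.I)) *
        Complex.exp (-((2 * Real.pi * w * h : ℝ) * Complex.I)) ^ k) := by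
    rw [← Complex.exp_nat_mul, ← Complex.exp_add, ← Complex.exp_add]
    congr 1
    push_cast
    ring
  simp only [F]
  rw [e]
  ring

theorem sum_lubichOp_fourierInv {α : ℝ} (hα : α ∈ Set.Ioo (1 : ℝ) 2) {f : ℝ → ℂ}
    (hf : Integrable f) (h : ℝ) (c : ℤ →₀ ℝ) (x : ℝ) :
    Integrable (fun w : ℝ => Complex.exp (2 * Real.pi * w * x * Complex.I) *
      (lubichSymbol α c (2 * Real.pi * w * h) * f w)) ∧
    (c.sum fun p a => a • lubichOp α h p (𝓕⁻ f) x) =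
      (1 / h ^ α) • ∫ w : ℝ, Complex.exp (2 * Real.pi * w * x * Complex.I) *
        (lubichSymbol α c (2 * Real.pi * w * h) * f w) := by
  let I : ℤ → ℝ → ℂ := fun p w => Complex.exp (2 * Real.pi * w * x * Complex.I) *
      (Complex.exp (p * ((2 * Real.pi * w * h : ℝ) * Complex.I)) *
        lubichGen α (Complex.exp (-((2 * Real.pi * w * h : ℝ) * Complex.I))) * f w)
  have hI : ∀ p, Integrable (I p) := fun p => integrable_cexp_mul_lubichGen_mul hα hf h p x
  have e : (fun w : ℝ => Complex.exp (2 * Real.pi * w * x * Complex.I) *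
      (lubichSymbol α c (2 * Real.pi * w * h) * f w)) =
      fun w => ∑ p ∈ c.support, (c p : ℂ) * I p w := by
    ext w
    rw [lubichSymbol, Finsupp.sum, Finset.sum_mul, Finset.mul_sum]
    refine Finset.sum_congr rfl fun p _ => ?_
    simp only [I]
    ring
  rw [e, integral_finsetSum _ fun p _ => (hI p).const_mul _]
  refine ⟨integrable_finsetSum _ fun p _ => (hI p).const_mul _, ?_⟩
  rw [Finset.smul_sum, Finsupp.sum]
  refine Finset.sum_congr rfl fun p _ => ?_
  rw [lubichOp, tsum_lubichCoeff_smul_fourierInv hα hf, integral_const_mul, smul_comm,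
    ← Complex.real_smul]

theorem lubichOp_congr {α h : ℝ} {u v : ℝ → ℂ} {x : ℝ}
    (huv : ∀ (k : ℕ) (p : ℤ), u (x - ((k : ℝ) - (p : ℝ)) * h) = v (x - ((k : ℝ) - (p : ℝ)) * h))
    (p : ℤ) : lubichOp α h p u x = lubichOp α h p v x := by
  simp only [lubichOp, huv]

theorem LubichSummable.congr {α h : ℝ} {u v : ℝ → ℂ} {x : ℝ} (hv : LubichSummable α h v x)
    (huv : ∀ (k : ℕ) (p : ℤ), u (x - ((k : ℝ) - (p : ℝ)) * h) = v (x - ((k : ℝ) - (p : ℝ)) * h)) :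
    LubichSummable α h u x := fun p => by
  simp only [huv]
  exact hv p

/-- Only countably many translates of a null set are involved. -/
theorem ae_forall_grid_eq {u v : ℝ → ℂ} (huv : ∀ᵐ x, u x = v x) (h : ℝ) :
    ∀ᵐ x, ∀ (k : ℕ) (p : ℤ),
      u (x - ((k : ℝ) - (p : ℝ)) * h) = v (x - ((k : ℝ) - (p : ℝ)) * h) := by
  refine ae_all_iff.mpr fun k => ae_all_iff.mpr fun p => ?_
  exact (measurePreserving_sub_right volume (((k : ℝ) - (p : ℝ)) * h)).quasiMeasurePreserving.ae huv

/-! ### From the symbol estimate to the error bound. -/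

theorem sq_mul_rlSymbolMul {α : ℝ} (f : ℝ → ℂ) {w : ℝ} (hw : w ≠ 0) :
    (2 * Real.pi * w * Complex.I) ^ 2 * rlSymbolMul (2 - α) f w =
      (2 * Real.pi * w * Complex.I) ^ (α : ℂ) * f w := by
  have hz : 2 * Real.pi * w * Complex.I ≠ 0 := by simp [hw, Real.pi_ne_zero]
  have harg : (2 * Real.pi * w * Complex.I).arg ≠ Real.pi := fun h => by
    have := (Complex.arg_eq_pi_iff.mp h).1
    simp at this
  rw [rlSymbolMul, one_div, Complex.inv_cpow _ _ harg, ← Complex.cpow_neg, ← mul_assoc]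
  congr 1
  have h2 : (2 * Real.pi * w * Complex.I) ^ 2 = (2 * Real.pi * w * Complex.I) ^ (2 : ℂ) := by
    exact_mod_cast (Complex.cpow_natCast (2 * Real.pi * w * Complex.I) 2).symm
  rw [h2, ← Complex.cpow_add _ _ hz]
  congr 1
  push_cast
  ring

/-- This converts integrability of the transform of the sixth derivative into the weight |w|^(α+4)
needed against the symbol error. -/
theorem norm_pow_six_mul_rlSymbolMul {α : ℝ} (f : ℝ → ℂ) {w : ℝ} (hw : w ≠ 0) :
    ‖(2 * Real.pi * w * Complex.I) ^ 6 * rlSymbolMul (2 - α) f w‖ =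
      (2 * Real.pi * |w|) ^ (α + 4) * ‖f w‖ := by
  have hpos : 0 < 2 * Real.pi * |w| := by have := abs_pos.mpr hw; positivity
  have e : (2 * Real.pi * w * Complex.I) ^ 6 * rlSymbolMul (2 - α) f w =
      (2 * Real.pi * w * Complex.I) ^ 4 * ((2 * Real.pi * w * Complex.I) ^ (α : ℂ) * f w) := by
    rw [← sq_mul_rlSymbolMul f hw]
    ring
  rw [e, norm_mul, norm_mul, norm_pow, Complex.norm_cpow_real, norm_two_pi_mul_I, ← mul_assoc,
    Real.rpow_add hpos, mul_comm (_ ^ α)]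
  congr 2
  exact_mod_cast (Real.rpow_natCast (2 * Real.pi * |w|) 4).symm

theorem integrable_pow_smul_of_integrable {G : ℝ → ℂ} (hG : Integrable G) {n : ℕ}
    (hGn : Integrable fun w : ℝ => (2 * Real.pi * w * Complex.I) ^ n * G w) {k : ℕ}
    (hk : k ≤ n) : Integrable fun w : ℝ => w ^ k • G w := by
  refine (hG.norm.add hGn.norm).mono'
    ((by fun_prop : Continuous fun w : ℝ => w ^ k).aestronglyMeasurable.smul
      hG.aestronglyMeasurable) (Eventually.of_forall fun w => ?_)
  have h1 : |w| ≤ 2 * Real.pi * |w| := by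
    have := abs_nonneg w
    nlinarith [Real.pi_gt_three]
  have h2 : |w| ^ k ≤ 1 + (2 * Real.pi * |w|) ^ n := by
    rcases le_total |w| 1 with h | h
    · have h3 := pow_le_one₀ (n := k) (abs_nonneg w) h
      have h4 : 0 ≤ (2 * Real.pi * |w|) ^ n := by positivity
      linarith
    · have h3 : |w| ^ k ≤ |w| ^ n := pow_le_pow_right₀ h hk
      have h4 : |w| ^ n ≤ (2 * Real.pi * |w|) ^ n := by gcongr
      linarith
  simp only [Pi.add_apply]
  rw [norm_smul, norm_pow, Real.norm_eq_abs, norm_mul, norm_pow, norm_two_pi_mul_I]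
  have := mul_le_mul_of_nonneg_right h2 (norm_nonneg (G w))
  linarith

/-- Consequently both derivatives start from the same fractional integral, of order 2 - α,
differentiated two and six times. -/
theorem floor_eq_one_and_floor_add_four {α : ℝ} (hα : α ∈ Set.Ioo (1 : ℝ) 2) :
    ⌊α⌋₊ = 1 ∧ ⌊α + 4⌋₊ = 5 := by
  have h0 : 0 ≤ α := by linarith [hα.1]
  constructor
  · rw [Nat.floor_eq_iff h0]
    constructor <;> push_cast <;> linarith [hα.1, hα.2]
  · rw [Nat.floor_eq_iff (by linarith)]
    constructor <;> push_cast <;> linarith [hα.1, hα.2]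

/-- The symbol error of a combination of shifted Lubich operators controls the error of the
approximation of the function with Fourier transform `(2πiw)^α f(w)`. -/
theorem norm_fourierInv_sub_sum_lubichOp_le {α : ℝ} (hα : α ∈ Set.Ioo (1 : ℝ) 2)
    {c : ℤ →₀ ℝ} {f g : ℝ → ℂ} (hf : Integrable f)
    (hg : Integrable g) (hgf : ∀ w : ℝ, w ≠ 0 → g w = (2 * Real.pi * w * Complex.I) ^ (α : ℂ) * f w)
    (hf' : Integrable fun w : ℝ => (2 * Real.pi * |w|) ^ (α + 4) * ‖f w‖) {C : ℝ}
    (hC : ∀ y : ℝ, y ≠ 0 →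
      ‖(y * Complex.I) ^ (α : ℂ) - lubichSymbol α c y‖ ≤ C * |y| ^ (α + 4))
    {h : ℝ} (hh : 0 < h) (x : ℝ) :
    ‖𝓕⁻ g x - c.sum fun p a => a • lubichOp α h p (𝓕⁻ f) x‖ ≤
      (C * ∫ w : ℝ, (2 * Real.pi * |w|) ^ (α + 4) * ‖f w‖) * h ^ 4 := by
  obtain ⟨hi, he⟩ := sum_lubichOp_fourierInv hα hf h c x
  have hhα : 0 < h ^ α := Real.rpow_pos_of_pos hh α
  have hi' : Integrable fun w : ℝ => (1 / h ^ α) •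
      (Complex.exp (2 * Real.pi * w * x * Complex.I) *
        (lubichSymbol α c (2 * Real.pi * w * h) * f w)) := hi.smul (1 / h ^ α)
  rw [he, fourierInv_real_eq_integral, ← integral_smul,
    ← integral_sub (integrable_cexp_mul hg x) hi']
  have hne : ∀ᵐ w : ℝ, w ≠ 0 := by simp [ae_iff]
  have hr : (C * ∫ w : ℝ, (2 * Real.pi * |w|) ^ (α + 4) * ‖f w‖) * h ^ 4 =
      ∫ w : ℝ, C * h ^ 4 * ((2 * Real.pi * |w|) ^ (α + 4) * ‖f w‖) := by
    rw [integral_const_mul]; ring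
  rw [hr]
  refine norm_integral_le_of_norm_le (hf'.const_mul _) ?_
  filter_upwards [hne] with w hw
  let y : ℝ := 2 * Real.pi * w * h
  have hy : y ≠ 0 := by
    have := Real.pi_ne_zero
    have := hh.ne'
    positivity
  have hz : 2 * Real.pi * w * Complex.I ≠ 0 := by simp [hw, Real.pi_ne_zero]
  -- Since h > 0, the power splits without a branch change; the factor h^α cancels the normalization
  -- of the operator.
  have hyz : ((y * Complex.I : ℂ)) ^ (α : ℂ) =
      (2 * Real.pi * w * Complex.I) ^ (α : ℂ) * ((h ^ α : ℝ) : ℂ) := by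
    rw [Complex.ofReal_cpow hh.le, ← mul_cpow_of_re hz (by simp) (by simpa using hh)]
    congr 1
    simp only [y]
    push_cast
    ring
  have hhc : ((h ^ α : ℝ) : ℂ) ≠ 0 := by exact_mod_cast hhα.ne'
  have e : Complex.exp (2 * Real.pi * w * x * Complex.I) * g w -
      (1 / h ^ α) • (Complex.exp (2 * Real.pi * w * x * Complex.I) *
        (lubichSymbol α c (2 * Real.pi * w * h) * f w)) =
      Complex.exp (2 * Real.pi * w * x * Complex.I) * (((h ^ α : ℝ) : ℂ)⁻¹ *
        (((y * Complex.I) ^ (α : ℂ) - lubichSymbol α c y) * f w)) := by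
    rw [hgf w hw, hyz, Complex.real_smul]
    push_cast
    field_simp
    rfl
  rw [e, norm_mul, norm_mul, norm_mul, norm_cexp_two_pi_mul, one_mul, norm_inv, Complex.norm_real,
    Real.norm_of_nonneg hhα.le]
  have hay : |y| = 2 * Real.pi * |w| * h := by
    simp only [y, abs_mul, abs_of_pos Real.pi_pos, abs_of_pos hh]
    norm_num
  have hb := hC y hy
  rw [hay, Real.mul_rpow (by positivity) hh.le, Real.rpow_add hh α] at hb
  have h4 : h ^ (4 : ℝ) = h ^ 4 := by exact_mod_cast Real.rpow_natCast h 4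
  rw [h4] at hb
  calc (h ^ α)⁻¹ * (‖(y * Complex.I) ^ (α : ℂ) - lubichSymbol α c y‖ * ‖f w‖)
      ≤ (h ^ α)⁻¹ * ((C * ((2 * Real.pi * |w|) ^ (α + 4) * (h ^ α * h ^ 4))) * ‖f w‖) := by
        gcongr
    _ = C * h ^ 4 * ((2 * Real.pi * |w|) ^ (α + 4) * ‖f w‖) := by
        field_simp

end

theorem theorem2p3 (α : ℝ) (hα : α ∈ Set.Ioo (1 : ℝ) 2) (u : ℝ → ℂ)
    (hu : Integrable u) (hu_hat : Integrable (𝓕 u))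
    (hD : RLDifferentiable (α + 4) u)
    (hDu : Integrable (rlDeriv (α + 4) u)) (hDu_hat : Integrable (𝓕 (rlDeriv (α + 4) u)))
    (p q r s p' q' r' s' : ℤ)
    (hpq : p ≠ q) (hrs : r ≠ s) (hpqrs : r * s ≠ p * q)
    (hpq' : p' ≠ q') (hrs' : r' ≠ s') (hpqrs' : r' * s' ≠ p' * q')
    (hab : coeffA p q r s * coeffB α p' q' r' s' ≠ coeffA p' q' r' s' * coeffB α p q r s) :
    RLDifferentiable α u ∧
    ∃ C : ℝ, ∀ h : ℝ, 0 < h →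
      (∀ᵐ x : ℝ, LubichSummable α h u x ∧
        ‖rlDeriv α u x - wsldOp4 α h p q r s p' q' r' s' u x‖ ≤ C * h ^ 4) ∧
      (Continuous u → ∀ x : ℝ, LubichSummable α h u x ∧
        ‖rlDeriv α u x - wsldOp4 α h p q r s p' q' r' s' u x‖ ≤ C * h ^ 4) := by
  obtain ⟨hfl, hfl'⟩ := floor_eq_one_and_floor_add_four hα
  have e1 : ((⌊α⌋₊ + 1 : ℕ) : ℝ) - α = 2 - α := by rw [hfl]; norm_num
  have e2 : ((⌊α + 4⌋₊ + 1 : ℕ) : ℝ) - (α + 4) = 2 - α := by rw [hfl']; push_cast; ring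
  have hσ : 2 - α ∈ Set.Ioo (0 : ℝ) 1 := ⟨by linarith [hα.2], by linarith [hα.1]⟩
  have n1 : ⌊α⌋₊ + 1 = 2 := by rw [hfl]
  have n2 : ⌊α + 4⌋₊ + 1 = 6 := by rw [hfl']
  rw [RLDifferentiable, e2, n2] at hD
  rw [rlDeriv, e2, n2] at hDu hDu_hat
  refine ⟨?_, ?_⟩
  · rw [RLDifferentiable, e1, n1]
    exact ⟨hD.1, fun k hk => hD.2 k (by omega)⟩
  -- This holds at every point, since integrals ignore null sets; hence it may be differentiated
  -- although `u` is recovered only almost everywhere.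
  have hF : rlIntegral (2 - α) u = 𝓕⁻ (rlSymbolMul (2 - α) (𝓕 u)) :=
    funext fun x => rlIntegral_eq_fourierInv hσ hu hu_hat (hD.1 x)
  have hG : Integrable (rlSymbolMul (2 - α) (𝓕 u)) :=
    integrable_rlSymbolMul hu_hat (norm_fourier_le_integral u) hσ
  rw [hF] at hDu hDu_hat hD
  have h6 : Integrable fun w : ℝ =>
      (2 * Real.pi * w * Complex.I) ^ 6 * rlSymbolMul (2 - α) (𝓕 u) w :=
    hDu_hat.congr (fourier_iteratedDeriv_fourierInv (by norm_num) hG hD.2 hDu hDu_hat)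
  have hk := fun (k : ℕ) (hk : k ≤ 6) => integrable_pow_smul_of_integrable hG h6 hk
  have hweight : Integrable fun w : ℝ => (2 * Real.pi * |w|) ^ (α + 4) * ‖𝓕 u w‖ := by
    refine h6.norm.congr ?_
    have hne : ∀ᵐ w : ℝ, w ≠ 0 := by simp [ae_iff]
    filter_upwards [hne] with w hw using norm_pow_six_mul_rlSymbolMul _ hw
  have hg : Integrable fun w : ℝ =>
      (2 * Real.pi * w * Complex.I) ^ 2 * rlSymbolMul (2 - α) (𝓕 u) w := by
    refine ((hk 2 (by norm_num)).const_mul ((2 * Real.pi * Complex.I) ^ 2)).congr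
      (Filter.Eventually.of_forall fun w => ?_)
    simp only [Complex.real_smul]
    push_cast
    ring
  have hderiv : rlDeriv α u = 𝓕⁻ ((fun w : ℝ =>
      (2 * Real.pi * w * Complex.I) ^ 2 * rlSymbolMul (2 - α) (𝓕 u) w) : ℝ → ℂ) := by
    rw [rlDeriv, e1, n1, hF, iteratedDeriv_fourierInv (by norm_num : 2 ≤ 6) hk]
  have hW := fourthOrderWeights_wsldWeights4 α hpq hrs hpqrs hpq' hrs' hpqrs' hab
  obtain ⟨C, hC⟩ := hW.norm_symbol_sub_le hα
  refine ⟨C * ∫ w : ℝ, (2 * Real.pi * |w|) ^ (α + 4) * ‖𝓕 u w‖, fun h hh => ?_⟩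
  -- The operator sees `u` only on the grid x - (k - p)h, so agreement with 𝓕⁻ (𝓕 u) there suffices:
  -- it holds for almost every x, and for every x if `u` is continuous.
  have main : ∀ x : ℝ, (∀ (k : ℕ) (p : ℤ), u (x - ((k : ℝ) - (p : ℝ)) * h) =
      𝓕⁻ (𝓕 u) (x - ((k : ℝ) - (p : ℝ)) * h)) → LubichSummable α h u x ∧
        ‖rlDeriv α u x - wsldOp4 α h p q r s p' q' r' s' u x‖ ≤
          (C * ∫ w : ℝ, (2 * Real.pi * |w|) ^ (α + 4) * ‖𝓕 u w‖) * h ^ 4 := by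
    intro x hx
    refine ⟨LubichSummable.congr (fun p => summable_lubichCoeff_smul hα
      (norm_fourierInv_le_integral (𝓕 u)) _) hx, ?_⟩
    rw [wsldOp4_eq_sum, hderiv]
    simp only [lubichOp_congr hx]
    exact norm_fourierInv_sub_sum_lubichOp_le hα hu_hat hg
      (fun w hw => sq_mul_rlSymbolMul _ hw) hweight hC hh x
  refine ⟨?_, fun hcont x => ?_⟩
  · filter_upwards [ae_forall_grid_eq (ae_eq_fourierInv_fourier hu hu_hat) h] with x hx
      using main x hx
  · exact main x fun k p => by rw [hcont.fourierInv_fourier_eq hu hu_hat]
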